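/- Let $d\in\{1,2,3\}$, $\Omega=(0,1)^d$, $\alpha>0$, $T>0$, and let $m_e:\overline\Omega\times[0,T]\to S^2\subset\mathbb R^3$, $m_e\in C^3([0,T];C^0(\overline\Omega))\cap L^\infty([0,T];C^4(\overline\Omega))$, be a classical solution of the exchange-only Landau–Lifshitz equation $$\partial_t m=-m\times\Delta m-\alpha\, m\times(m\times\Delta m)\ \text{ in }\overline\Omega\times[0,T],\qquad \partial_\nu m=0\ \text{ on }\partial\Omega .$$ For $N\ge1$ put $h=1/N$ and consider $\mathbb R^3$-valued grid functions $f=(f_I)$ on the cell centres $\big((I_1-\tfrac12)h,\dots,(I_d-\tfrac12)h\big)$, $I\in\{1,\dots,N\}^d$, extended to ghost points by $f_{\dots,0,\dots}=f_{\dots,1,\dots}$ and $f_{\dots,N+1,\dots}=f_{\dots,N,\dots}$ in each direction. Let $$\Delta_hf_I=\sum_{i=1}^d\frac{f_{I+e_i}-2f_I+f_{I-e_i}}{h^2},\qquad (\nabla_hf_I)_i=\frac{f_{I+e_i}-f_I}{h},$$ $$\|f\|_2=\Big(h^d\sum_I|f_I|^2\Big)^{1/2},\qquad \|\nabla_hf\|_2=\Big(h^d\sum_I\sum_{i=1}^d|(\nabla_hf_I)_i|^2\Big)^{1/2}.$$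 For a time step $k>0$ let $m_{e,h}^n$ be the grid function of the values of $m_e(\cdot,nk)$. Given starting values $\tilde m_h^0,\tilde m_h^1,m_h^0,m_h^1$, the BDF2 semi-implicit projection scheme is, for $n\ge0$ with $(n+2)k\le T$, $$\frac{\tfrac32\tilde m_h^{n+2}-2\tilde m_h^{n+1}+\tfrac12\tilde m_h^{n}}{k}=-\hat m_h^{n+2}\times\Delta_h\tilde m_h^{n+2}-\alpha\,\hat m_h^{n+2}\times\big(\hat m_h^{n+2}\times\Delta_h\tilde m_h^{n+2}\big),$$ $$\hat m_h^{n+2}=2m_h^{n+1}-m_h^n,\qquad m_h^{n+2}=\frac{\tilde m_h^{n+2}}{|\tilde m_h^{n+2}|}.$$ Then for all constants $C_0,C_1$ there is a constant $C>0$, depending only on $d,\alpha,T,m_e,C_0,C_1$ (in particular independent of $k$ and $h$), such that the following holds. If $k\le C_0h$, and $(\tilde m_h^n,m_h^n)$ solves the scheme with starting values that satisfy, for $\ell=0,1$, $$\|m_{e,h}^\ell-m_h^\ell\|_2+\|\nabla_h(m_{e,h}^\ell-m_h^\ell)\|_2\le C_1(k^2+h^2),\qquad \|m_{e,h}^\ell-\tilde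 m_h^\ell\|_2+\|\nabla_h(m_{e,h}^\ell-\tilde m_h^\ell)\|_2\le C_1(k^2+h^2)$$ (one condition if $\tilde m_h^\ell=m_h^\ell$), then $$\|m_{e,h}^n-m_h^n\|_2+\|\nabla_h(m_{e,h}^n-m_h^n)\|_2\le C(k^2+h^2)\qquad\text{for all } n\ge2\text{ with } nk\le T .$$ -/

import Mathlib

open Set MeasureTheory

noncomputable section

namespace LandauLifshitz

/-- Spatial points. -/
abbrev Space (d : ℕ) : Type := EuclideanSpace ℝ (Fin d)

/-- Magnetization vectors: `ℝ³` with its Euclidean norm. -/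
abbrev Vec3 : Type := EuclideanSpace ℝ (Fin 3)

/-- The cross product of `ℝ³`. -/
def cross (a b : Vec3) : Vec3 := WithLp.toLp 2 (crossProduct a.ofLp b.ofLp)

/-- The closed unit cube `[0,1]^d`. -/
def cube (d : ℕ) : Set (Space d) := {x | ∀ i, x i ∈ Icc (0 : ℝ) 1}

theorem isCompact_cube (d : ℕ) : IsCompact (cube d) := by
  have h : IsCompact (Set.pi univ fun _ : Fin d => Icc (0 : ℝ) 1) :=
    isCompact_univ_pi fun _ => isCompact_Icc
  have h2 := (EuclideanSpace.equiv (Fin d) ℝ).symm.toHomeomorph.isCompact_image.mpr h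
  convert h2 using 1
  ext x
  constructor
  · intro hx
    exact ⟨x.ofLp, fun i _ => hx i, rfl⟩
  · rintro ⟨y, hy, rfl⟩ i
    exact hy i (mem_univ i)

/-- Compactness of the cube; with it `C(cube d, Vec3)` is a normed space under the sup norm. -/
instance compactSpace_cube (d : ℕ) : CompactSpace (cube d) :=
  isCompact_iff_compactSpace.mp (isCompact_cube d)

/-- The time dependent field `m` belongs to `C³([0,T]; C⁰(Ω̄))`, `Ω̄ = [0,1]^d`: as a map of time
into the Banach space of continuous fields on the closed cube it is three times continuously
differentiable on the closed interval `[0,T]`. -/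
def TimeRegular (d : ℕ) (T : ℝ) (m : ℝ → Space d → Vec3) : Prop :=
  ∃ U : ℝ → C(cube d, Vec3), ContDiffOn ℝ 3 U (Icc 0 T) ∧
    ∀ t ∈ Icc 0 T, ∀ x : cube d, U t x = m t x

/-- The time dependent field `m` belongs to `L^∞([0,T]; C⁴(Ω̄))`: for almost every `t`, `m t` is
four times continuously differentiable up to the boundary of the cube, and all derivatives of
order at most four are bounded by one constant. -/
def SpaceRegular (d : ℕ) (T : ℝ) (m : ℝ → Space d → Vec3) : Prop :=
  ∃ M : ℝ, ∀ᵐ t ∂(volume.restrict (Icc 0 T)),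
    ContDiffOn ℝ 4 (m t) (cube d) ∧
      ∀ j ≤ 4, ∀ x ∈ cube d, ‖iteratedFDerivWithin ℝ j (m t) (cube d) x‖ ≤ M

/-- `m` is a classical solution, on `[0,1]^d × [0,T]` and with values in the unit sphere, of
`∂ₜ m = - m × Δm - α m × (m × Δm)`, `∂m/∂ν = 0` on the boundary, in the regularity class
`C³([0,T]; C⁰) ∩ L^∞([0,T]; C⁴)`. -/
structure IsSmoothSolution (d : ℕ) (α T : ℝ) (m : ℝ → Space d → Vec3) : Prop where
  time_regular : TimeRegular d T m
  space_regular : SpaceRegular d T m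
  /-- At every time the spatial derivatives in the equation exist classically. -/
  classical : ∀ t ∈ Icc 0 T, ContDiffOn ℝ 2 (m t) (cube d)
  unit_length : ∀ t ∈ Icc 0 T, ∀ x ∈ cube d, ‖m t x‖ = 1
  equation : ∀ t ∈ Icc 0 T, ∀ x ∈ cube d,
    derivWithin (fun s => m s x) (Icc 0 T) t =
      - cross (m t x) (InnerProductSpace.laplacianWithin (m t) (cube d) x)
      - α • cross (m t x)
          (cross (m t x) (InnerProductSpace.laplacianWithin (m t) (cube d) x))
  /-- Homogeneous Neumann condition on the faces `x_i = 0` and `x_i = 1`. -/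
  neumann : ∀ t ∈ Icc 0 T, ∀ x ∈ cube d, ∀ i : Fin d, x i = 0 ∨ x i = 1 →
    fderivWithin ℝ (m t) (cube d) x (EuclideanSpace.single i 1) = 0

/-! ### The finite difference grid -/

/-- Vector valued grid functions on the `N^d` cell centres. Indices run from `0` to `N - 1`. -/
abbrev Grid (d N : ℕ) : Type := (Fin d → Fin N) → Vec3

/-- The mesh size `h = 1 / N`. -/
def mesh (N : ℕ) : ℝ := 1 / (N : ℝ)

/-- The cell centre with index `I`: its `i`-th coordinate is `(I i + 1/2) h`. -/
def gridPoint (d N : ℕ) (I : Fin d → Fin N) : Space d :=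
  WithLp.toLp 2 fun i => (((I i : ℕ) : ℝ) + 1 / 2) * mesh N

/-- The grid function of point values of a field. -/
def restrictGrid (d N : ℕ) (u : Space d → Vec3) : Grid d N := fun I => u (gridPoint d N I)

/-- The next index in one direction. The ghost point behind the last cell carries the value of
that cell, so the successor of the last index is that index. -/
def nextIdx {N : ℕ} (j : Fin N) : Fin N := if h : (j : ℕ) + 1 < N then ⟨j + 1, h⟩ else j

/-- The previous index in one direction. The ghost point before the first cell carries the value
of that cell, so the predecessor of the first index is that index. -/
def prevIdx {N : ℕ} (j : Fin N) : Fin N := ⟨(j : ℕ) - 1, lt_of_le_of_lt (Nat.sub_le _ _) j.isLt⟩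

/-- The value at the neighbour of the cell `I` in the direction `+ e_i`, with the ghost point
extrapolation of the Neumann condition. -/
def fwd {d N : ℕ} (f : Grid d N) (i : Fin d) (I : Fin d → Fin N) : Vec3 :=
  f (Function.update I i (nextIdx (I i)))

/-- The value at the neighbour of the cell `I` in the direction `- e_i`, with the ghost point
extrapolation of the Neumann condition. -/
def bwd {d N : ℕ} (f : Grid d N) (i : Fin d) (I : Fin d → Fin N) : Vec3 :=
  f (Function.update I i (prevIdx (I i)))

/-- The discrete Laplacian `Δ_h`. -/
def lapH {d N : ℕ} (f : Grid d N) : Grid d N := fun I =>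
  ∑ i : Fin d, (1 / mesh N ^ 2) • (fwd f i I - (2 : ℝ) • f I + bwd f i I)

/-- The discrete gradient `∇_h`: the row `i` at the cell `I` is the forward difference quotient. -/
def gradH {d N : ℕ} (f : Grid d N) (I : Fin d → Fin N) (i : Fin d) : Vec3 :=
  (1 / mesh N) • (fwd f i I - f I)

/-- The discrete norm `‖f‖₂ = (h^d ∑_I |f_I|²)^{1/2}`. -/
def normH {d N : ℕ} (f : Grid d N) : ℝ :=
  Real.sqrt (mesh N ^ d * ∑ I : Fin d → Fin N, ‖f I‖ ^ 2)

/-- The discrete norm `‖∇_h f‖₂`. -/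
def normGradH {d N : ℕ} (f : Grid d N) : ℝ :=
  Real.sqrt (mesh N ^ d * ∑ I : Fin d → Fin N, ∑ i : Fin d, ‖gradH f I i‖ ^ 2)

/-- `‖m_{e,h}^n - f‖₂ + ‖∇_h (m_{e,h}^n - f)‖₂` with `m_{e,h}^n` the point values of the field `me`
at the time `t^n = n k`. -/
def errH {d N : ℕ} (me : ℝ → Space d → Vec3) (k : ℝ) (n : ℕ) (f : Grid d N) : ℝ :=
  normH (restrictGrid d N (me (n * k)) - f) + normGradH (restrictGrid d N (me (n * k)) - f)

/-- The extrapolated coefficient `m̂^{n+2} = 2 m^{n+1} - m^n`. -/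
def extrap {d N : ℕ} (m : ℕ → Grid d N) (n : ℕ) : Grid d N := (2 : ℝ) • m (n + 1) - m n

/-- The pair of sequences `mt` (intermediate magnetization `m̃_h^n`) and `m` (projected
magnetization `m_h^n`) solves the BDF2 semi-implicit projection scheme with time step `k` up to the
final time `T`. The starting values `mt 0`, `mt 1`, `m 0`, `m 1` are data of the scheme. -/
structure IsSchemeSolution {d N : ℕ} (α T k : ℝ) (mt m : ℕ → Grid d N) : Prop where
  step : ∀ n : ℕ, ((n + 2 : ℕ) : ℝ) * k ≤ T → ∀ I : Fin d → Fin N,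
    (1 / k) • ((3 / 2 : ℝ) • mt (n + 2) I - (2 : ℝ) • mt (n + 1) I + (1 / 2 : ℝ) • mt n I) =
      - cross (extrap m n I) (lapH (mt (n + 2)) I)
      - α • cross (extrap m n I) (cross (extrap m n I) (lapH (mt (n + 2)) I))
  projection : ∀ n : ℕ, ((n + 2 : ℕ) : ℝ) * k ≤ T → ∀ I : Fin d → Fin N,
    m (n + 2) I = (1 / ‖mt (n + 2) I‖) • mt (n + 2) I

end LandauLifshitz

end

namespace LandauLifshitz

theorem inner_eq_coord (a b : Vec3) : inner ℝ a b = a 0 * b 0 + a 1 * b 1 + a 2 * b 2 := by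
  simp [PiLp.inner_apply, Fin.sum_univ_three]; ring

theorem cross_apply_zero (a b : Vec3) : cross a b 0 = a 1 * b 2 - a 2 * b 1 := by
  simp [cross, crossProduct]

theorem cross_apply_one (a b : Vec3) : cross a b 1 = a 2 * b 0 - a 0 * b 2 := by
  simp [cross, crossProduct]

theorem cross_apply_two (a b : Vec3) : cross a b 2 = a 0 * b 1 - a 1 * b 0 := by
  simp [cross, crossProduct]

theorem cross_add_left (a b c : Vec3) : cross (a + b) c = cross a c + cross b c := by
  simp [cross]

theorem cross_add_right (a b c : Vec3) : cross a (b + c) = cross a b + cross a c := by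
  simp [cross]

theorem cross_smul_left (r : ℝ) (a b : Vec3) : cross (r • a) b = r • cross a b := by
  simp [cross]

theorem cross_smul_right (r : ℝ) (a b : Vec3) : cross a (r • b) = r • cross a b := by
  simp [cross]

theorem cross_sub_left (a b c : Vec3) : cross (a - b) c = cross a c - cross b c := by
  simp [cross]

theorem cross_sub_right (a b c : Vec3) : cross a (b - c) = cross a b - cross a c := by
  simp [cross]

theorem inner_cross_self_left (a b : Vec3) : inner ℝ (cross a b) a = 0 := by
  simp only [inner_eq_coord, cross_apply_zero, cross_apply_one, cross_apply_two]; ring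

theorem inner_cross_self_right (a b : Vec3) : inner ℝ (cross a b) b = 0 := by
  simp only [inner_eq_coord, cross_apply_zero, cross_apply_one, cross_apply_two]; ring

theorem inner_cross_left (a b c : Vec3) : inner ℝ (cross a b) c = - inner ℝ b (cross a c) := by
  simp only [inner_eq_coord, cross_apply_zero, cross_apply_one, cross_apply_two]; ring

/-- The Binet–Cauchy identity with a common factor. -/
theorem normSq_mul_inner (a b c : Vec3) :
    ‖a‖ ^ 2 * inner ℝ b c =
      inner ℝ a b * inner ℝ a c + inner ℝ (cross a b) (cross a c) := by
  rw [← real_inner_self_eq_norm_sq]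
  simp only [inner_eq_coord, cross_apply_zero, cross_apply_one, cross_apply_two]; ring

theorem norm_cross_le (a b : Vec3) : ‖cross a b‖ ≤ ‖a‖ * ‖b‖ := by
  have h := normSq_mul_inner a b b
  rw [real_inner_self_eq_norm_sq, real_inner_self_eq_norm_sq] at h
  refine le_of_sq_le_sq ?_ (by positivity)
  nlinarith [mul_self_nonneg (inner ℝ a b : ℝ)]

/-- The cross product as a continuous bilinear map. -/
noncomputable def crossL : Vec3 →L[ℝ] Vec3 →L[ℝ] Vec3 :=
  LinearMap.mkContinuous₂
    (LinearMap.mk₂ ℝ cross cross_add_left cross_smul_left cross_add_right cross_smul_right) 1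
    fun a b => by simpa using norm_cross_le a b

theorem crossL_apply (a b : Vec3) : crossL a b = cross a b := rfl

/-! ### Sums over the grid -/

section Grid

variable {d N : ℕ}

/-- Shifting a sum by one cell; the terms at the ghost points vanish. -/
theorem sum_prev_eq_sum_next (i : Fin d) (F : (Fin d → Fin N) → (Fin d → Fin N) → ℝ)
    (hF : ∀ I, F I I = 0) :
    ∑ I, F I (Function.update I i (prevIdx (I i))) =
      ∑ I, F (Function.update I i (nextIdx (I i))) I := by
  classical
  have h1 : ∑ I, F I (Function.update I i (prevIdx (I i))) =
      ∑ I with 0 < (I i : ℕ), F I (Function.update I i (prevIdx (I i))) := by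
    rw [Finset.sum_filter_of_ne]
    intro I _ hI
    by_contra h0
    apply hI
    have : prevIdx (I i) = I i := by
      ext; simp [prevIdx]; omega
    rw [this, Function.update_eq_self, hF]
  have h2 : ∑ I, F (Function.update I i (nextIdx (I i))) I =
      ∑ I with (I i : ℕ) + 1 < N, F (Function.update I i (nextIdx (I i))) I := by
    rw [Finset.sum_filter_of_ne]
    intro I _ hI
    by_contra h0
    apply hI
    have : nextIdx (I i) = I i := by
      simp [nextIdx, h0]
    rw [this, Function.update_eq_self, hF]
  have key1 : ∀ j : Fin N, 0 < (j : ℕ) → nextIdx (prevIdx j) = j := by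
    intro j hj
    have := j.isLt
    ext
    have : (j : ℕ) - 1 + 1 < N := by omega
    simp [nextIdx, prevIdx, this]; omega
  have key2 : ∀ j : Fin N, (j : ℕ) + 1 < N → prevIdx (nextIdx j) = j := by
    intro j hj
    ext
    simp [nextIdx, prevIdx, hj]
  rw [h1, h2]
  refine Finset.sum_nbij' (fun I => Function.update I i (prevIdx (I i)))
    (fun I => Function.update I i (nextIdx (I i))) ?_ ?_ ?_ ?_ ?_
  · intro I hI
    simp only [Finset.mem_filter, Finset.mem_univ, true_and] at hI ⊢
    have := (I i).isLt
    simp [prevIdx]; omega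
  · intro I hI
    simp only [Finset.mem_filter, Finset.mem_univ, true_and] at hI ⊢
    simp [nextIdx, hI]
  · intro I hI
    simp only [Finset.mem_filter, Finset.mem_univ, true_and] at hI
    simp [key1 _ hI]
  · intro I hI
    simp only [Finset.mem_filter, Finset.mem_univ, true_and] at hI
    simp [key2 _ hI]
  · intro I hI
    simp only [Finset.mem_filter, Finset.mem_univ, true_and] at hI
    simp [key1 _ hI]

theorem sum_inner_second_difference (f g : Grid d N) (i : Fin d) :
    ∑ I, inner ℝ (f I) (fwd g i I - (2 : ℝ) • g I + bwd g i I) =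
      - ∑ I, inner ℝ (fwd f i I - f I) (fwd g i I - g I) := by
  have h := sum_prev_eq_sum_next i (fun I J => inner ℝ (f I) (g I - g J)) (by simp)
  have h1 : ∀ I, inner ℝ (f I) (fwd g i I - (2 : ℝ) • g I + bwd g i I) =
      inner ℝ (f I) (fwd g i I - g I) -
        inner ℝ (f I) (g I - g (Function.update I i (prevIdx (I i)))) := by
    intro I
    rw [← inner_sub_right]
    congr 1
    simp only [bwd]; module
  rw [Finset.sum_congr rfl fun I _ => h1 I, Finset.sum_sub_distrib, h, ← Finset.sum_sub_distrib,
    ← Finset.sum_neg_distrib]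
  refine Finset.sum_congr rfl fun I _ => ?_
  simp only [inner_sub_left, fwd]
  ring

/-- Summation by parts on the grid with the ghost point extrapolation. -/
theorem sum_inner_lapH (f g : Grid d N) :
    ∑ I, inner ℝ (f I) (lapH g I) = - ∑ I, ∑ i, inner ℝ (gradH f I i) (gradH g I i) := by
  simp only [lapH, inner_sum, real_inner_smul_right]
  rw [Finset.sum_comm, Finset.sum_comm (f := fun I i => inner ℝ (gradH f I i) (gradH g I i)),
    ← Finset.sum_neg_distrib]
  refine Finset.sum_congr rfl fun i _ => ?_
  rw [← Finset.mul_sum, sum_inner_second_difference]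
  simp only [gradH, real_inner_smul_left, real_inner_smul_right]
  rw [mul_neg, Finset.mul_sum]
  congr 1
  refine Finset.sum_congr rfl fun I _ => ?_
  ring

theorem mesh_pos (hN : 0 < N) : 0 < mesh N := by
  unfold mesh; positivity

theorem mesh_le_one : mesh N ≤ 1 := by
  unfold mesh
  rcases Nat.eq_zero_or_pos N with h | h
  · simp [h]
  · rw [div_le_one (by positivity)]; exact_mod_cast h

theorem gradH_sub (f g : Grid d N) (I : Fin d → Fin N) (i : Fin d) :
    gradH (f - g) I i = gradH f I i - gradH g I i := by
  simp only [gradH, fwd, Pi.sub_apply]; module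

theorem gradH_add (f g : Grid d N) (I : Fin d → Fin N) (i : Fin d) :
    gradH (f + g) I i = gradH f I i + gradH g I i := by
  simp only [gradH, fwd, Pi.add_apply]; module

theorem gradH_smul (r : ℝ) (f : Grid d N) (I : Fin d → Fin N) (i : Fin d) :
    gradH (r • f) I i = r • gradH f I i := by
  simp only [gradH, fwd, Pi.smul_apply]; module

theorem lapH_sub (f g : Grid d N) (I : Fin d → Fin N) :
    lapH (f - g) I = lapH f I - lapH g I := by
  simp only [lapH, ← Finset.sum_sub_distrib]
  refine Finset.sum_congr rfl fun i _ => ?_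
  simp only [fwd, bwd, Pi.sub_apply]; module

theorem norm_sub_sq_le (a b : Vec3) : ‖a - b‖ ^ 2 ≤ 2 * ‖a‖ ^ 2 + 2 * ‖b‖ ^ 2 := by
  have := norm_sub_le a b
  nlinarith [norm_nonneg (a - b), sq_nonneg (‖a‖ - ‖b‖)]

/-- The inverse inequality `h² ‖Δ_h f‖² ≤ 4 d ‖∇_h f‖²`. -/
theorem sum_sq_lapH_le (hN : 0 < N) (f : Grid d N) :
    ∑ I, mesh N ^ 2 * ‖lapH f I‖ ^ 2 ≤ 4 * (d : ℝ) * ∑ I, ∑ i, ‖gradH f I i‖ ^ 2 := by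
  have hh := mesh_pos hN
  have hcell : ∀ I, mesh N ^ 2 * ‖lapH f I‖ ^ 2 ≤ d * ∑ i, (2 * ‖gradH f I i‖ ^ 2 +
      2 * ‖(1 / mesh N) • (f I - f (Function.update I i (prevIdx (I i))))‖ ^ 2) := by
    intro I
    have e1 : mesh N • lapH f I = ∑ i, (gradH f I i -
        (1 / mesh N) • (f I - f (Function.update I i (prevIdx (I i))))) := by
      simp only [lapH, Finset.smul_sum]
      refine Finset.sum_congr rfl fun i _ => ?_
      simp only [gradH, bwd, smul_smul, ← smul_sub]
      rw [show mesh N * (1 / mesh N ^ 2) = 1 / mesh N by field_simp]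
      congr 1; module
    have e2 : mesh N ^ 2 * ‖lapH f I‖ ^ 2 = ‖mesh N • lapH f I‖ ^ 2 := by
      rw [norm_smul, Real.norm_of_nonneg hh.le]; ring
    rw [e2, e1]
    calc _ ≤ (∑ i, ‖gradH f I i -
        (1 / mesh N) • (f I - f (Function.update I i (prevIdx (I i))))‖) ^ 2 := by
          gcongr; exact norm_sum_le _ _
      _ ≤ d * ∑ i, ‖gradH f I i -
        (1 / mesh N) • (f I - f (Function.update I i (prevIdx (I i))))‖ ^ 2 := by
          have := sq_sum_le_card_mul_sum_sq (s := (Finset.univ : Finset (Fin d)))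
            (f := fun i => ‖gradH f I i -
              (1 / mesh N) • (f I - f (Function.update I i (prevIdx (I i))))‖)
          simpa using this
      _ ≤ _ := by
          gcongr with i
          exact norm_sub_sq_le _ _
  have hshift : ∀ i : Fin d,
      ∑ I, ‖(1 / mesh N) • (f I - f (Function.update I i (prevIdx (I i))))‖ ^ 2 =
      ∑ I, ‖gradH f I i‖ ^ 2 := fun i =>
    sum_prev_eq_sum_next i (fun I J => ‖(1 / mesh N) • (f I - f J)‖ ^ 2) (by simp)
  calc _ ≤ ∑ I, (d : ℝ) * ∑ i, (2 * ‖gradH f I i‖ ^ 2 +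
      2 * ‖(1 / mesh N) • (f I - f (Function.update I i (prevIdx (I i))))‖ ^ 2) :=
        Finset.sum_le_sum fun I _ => hcell I
    _ = 4 * (d : ℝ) * ∑ I, ∑ i, ‖gradH f I i‖ ^ 2 := by
        rw [← Finset.mul_sum, Finset.sum_comm,
          Finset.sum_comm (f := fun I i => ‖gradH f I i‖ ^ 2)]
        simp only [Finset.sum_add_distrib, ← Finset.mul_sum, hshift]
        ring

theorem mesh_pow_mul_card (hN : 0 < N) :
    mesh N ^ d * ∑ _I : Fin d → Fin N, (1 : ℝ) = 1 := by
  have : (N : ℝ) ≠ 0 := by positivity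
  simp [mesh]; field_simp

/-! ### The energy estimate for one step -/

/-- The squared discrete `H¹` norm `‖f‖₂² + ‖∇_h f‖₂²`. -/
noncomputable def energy (f : Grid d N) : ℝ :=
  mesh N ^ d * ∑ I, (‖f I‖ ^ 2 + ∑ i, ‖gradH f I i‖ ^ 2)

theorem energy_nonneg (f : Grid d N) : 0 ≤ energy f := by
  unfold energy
  have : 0 ≤ mesh N := by unfold mesh; positivity
  positivity

/-- The stability identity of the second order backward difference formula. -/
theorem bdf_identity (a b c : Vec3) :
    4 * inner ℝ ((3 / 2 : ℝ) • a - (2 : ℝ) • b + (1 / 2 : ℝ) • c) a =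
      ‖a‖ ^ 2 + ‖(2 : ℝ) • a - b‖ ^ 2 - ‖b‖ ^ 2 - ‖(2 : ℝ) • b - c‖ ^ 2 +
        ‖a - (2 : ℝ) • b + c‖ ^ 2 := by
  simp only [← real_inner_self_eq_norm_sq, inner_eq_coord, PiLp.add_apply, PiLp.sub_apply,
    PiLp.smul_apply, smul_eq_mul]
  ring

theorem mul_le_sq_add_sq (x y : ℝ) : x * y ≤ x ^ 2 + y ^ 2 := by
  nlinarith [sq_nonneg (x - y), sq_nonneg x, sq_nonneg y]

theorem absorb_into_dissipation {α K h A E V z : ℝ} (hα : 0 < α) (hK : 0 ≤ K) (hh : 0 < h)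
    (hh1 : h ≤ 1) (hE : 0 ≤ E) (hV : 0 ≤ V) :
    (z * (1 + 5 * α) + E * (K * (1 + 8 * α)) + K * h ^ 2) * A - α * z ^ 2 + α * (E * K * z) +
      (3 * (K * h ^ 3) * V + 3 * (K * h ^ 2) * (z + E * V)) ≤
    ((1 + 5 * α) ^ 2 / α + α * K ^ 2 + 9 * K ^ 2 / α + K * (1 + 8 * α) + 7 * K) *
      (A ^ 2 + E ^ 2 + h ^ 4 + h ^ 2 * V ^ 2) := by
  have y1 : z * (1 + 5 * α) * A ≤ α / 4 * z ^ 2 + (1 + 5 * α) ^ 2 / α * A ^ 2 := by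
    have : α / 4 * z ^ 2 + (1 + 5 * α) ^ 2 / α * A ^ 2 - z * (1 + 5 * α) * A =
      (α * z / 2 - (1 + 5 * α) * A) ^ 2 / α := by field_simp; ring
    have : 0 ≤ (α * z / 2 - (1 + 5 * α) * A) ^ 2 / α := by positivity
    linarith
  have y2 : α * (E * K * z) ≤ α / 4 * z ^ 2 + α * K ^ 2 * E ^ 2 := by
    have : 0 ≤ α * (z / 2 - E * K) ^ 2 := by positivity
    linarith
  have y3 : 3 * (K * h ^ 2) * z ≤ α / 4 * z ^ 2 + 9 * K ^ 2 / α * h ^ 4 := by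
    have : α / 4 * z ^ 2 + 9 * K ^ 2 / α * h ^ 4 - 3 * (K * h ^ 2) * z =
      (α * z / 2 - 3 * (K * h ^ 2)) ^ 2 / α := by field_simp; ring
    have : 0 ≤ (α * z / 2 - 3 * (K * h ^ 2)) ^ 2 / α := by positivity
    linarith
  have y4 : E * (K * (1 + 8 * α)) * A ≤ K * (1 + 8 * α) * (A ^ 2 + E ^ 2) := by
    have : E * A ≤ A ^ 2 + E ^ 2 := by
      linarith [mul_le_sq_add_sq E A]
    have h0 : 0 ≤ K * (1 + 8 * α) := by positivity
    calc _ = K * (1 + 8 * α) * (E * A) := by ring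
      _ ≤ _ := by gcongr
  have y5 : K * h ^ 2 * A ≤ K * (A ^ 2 + h ^ 4) := by
    have : h ^ 2 * A ≤ A ^ 2 + h ^ 4 := by
      linarith [mul_le_sq_add_sq (h ^ 2) A]
    calc _ = K * (h ^ 2 * A) := by ring
      _ ≤ _ := by gcongr
  have y6 : 3 * (K * h ^ 3) * V ≤ 3 * K * (h ^ 4 + h ^ 2 * V ^ 2) := by
    have : h ^ 2 * (h * V) ≤ h ^ 4 + h ^ 2 * V ^ 2 := by
      linarith [mul_le_sq_add_sq (h ^ 2) (h * V)]
    calc _ = 3 * K * (h ^ 2 * (h * V)) := by ring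
      _ ≤ _ := by gcongr
  have y7 : 3 * (K * h ^ 2) * (E * V) ≤ 3 * K * (E ^ 2 + h ^ 2 * V ^ 2) := by
    have h2 : h ^ 2 ≤ h := by nlinarith
    have : h ^ 2 * (E * V) ≤ E ^ 2 + h ^ 2 * V ^ 2 := by
      calc _ ≤ h * (E * V) := by gcongr
        _ ≤ _ := by linarith [mul_le_sq_add_sq E (h * V)]
    calc _ = 3 * K * (h ^ 2 * (E * V)) := by ring
      _ ≤ _ := by gcongr
  have r : (1 + 5 * α) ^ 2 / α * A ^ 2 + α * K ^ 2 * E ^ 2 + 9 * K ^ 2 / α * h ^ 4 +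
      K * (1 + 8 * α) * (A ^ 2 + E ^ 2) + K * (A ^ 2 + h ^ 4) +
      3 * K * (h ^ 4 + h ^ 2 * V ^ 2) + 3 * K * (E ^ 2 + h ^ 2 * V ^ 2) ≤
      ((1 + 5 * α) ^ 2 / α + α * K ^ 2 + 9 * K ^ 2 / α + K * (1 + 8 * α) + 7 * K) *
        (A ^ 2 + E ^ 2 + h ^ 4 + h ^ 2 * V ^ 2) := by
    have q1 := sq_nonneg A
    have q2 := sq_nonneg E
    have q3 : 0 ≤ h ^ 4 := by positivity
    have q4 : 0 ≤ h ^ 2 * V ^ 2 := by positivity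
    calc _ ≤ (1 + 5 * α) ^ 2 / α * (A ^ 2 + E ^ 2 + h ^ 4 + h ^ 2 * V ^ 2) +
        α * K ^ 2 * (A ^ 2 + E ^ 2 + h ^ 4 + h ^ 2 * V ^ 2) +
        9 * K ^ 2 / α * (A ^ 2 + E ^ 2 + h ^ 4 + h ^ 2 * V ^ 2) +
        K * (1 + 8 * α) * (A ^ 2 + E ^ 2 + h ^ 4 + h ^ 2 * V ^ 2) +
        K * (A ^ 2 + E ^ 2 + h ^ 4 + h ^ 2 * V ^ 2) +
        3 * K * (A ^ 2 + E ^ 2 + h ^ 4 + h ^ 2 * V ^ 2) +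
        3 * K * (A ^ 2 + E ^ 2 + h ^ 4 + h ^ 2 * V ^ 2) := by
          gcongr ?_ * ?_ + ?_ * ?_ + ?_ * ?_ + ?_ * ?_ + ?_ * ?_ + ?_ * ?_ + ?_ * ?_ <;>
            linarith only [q1, q2, q3, q4]
      _ = _ := by ring
  have : 0 ≤ α / 4 * z ^ 2 := by positivity
  linarith only [y1, y2, y3, y4, y5, y6, y7, r, this]

theorem inner_step_le {α K h : ℝ} (hα : 0 < α) (hK : 0 ≤ K) (hh : 0 < h) (hh1 : h ≤ 1)
    {D a v mh eh Mh W τ : Vec3} (hM : Mh = mh + eh)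
    (hD : D = - cross mh v - α • cross mh (cross mh v) - cross eh W
      - α • (cross eh (cross Mh W) + cross mh (cross eh W)) + τ)
    (hmh : ‖mh‖ ≤ 5) (hMh : ‖Mh‖ ≤ 3) (hMh1 : 1 ≤ ‖Mh‖) (hW : ‖W‖ ≤ K)
    (hτ : ‖τ‖ ≤ K * h ^ 2) (hMτ : |inner ℝ Mh τ| ≤ K * h ^ 3) :
    inner ℝ D (a - v) ≤
      ((1 + 5 * α) ^ 2 / α + α * K ^ 2 + 9 * K ^ 2 / α + K * (1 + 8 * α) + 7 * K) *
        (‖a‖ ^ 2 + ‖eh‖ ^ 2 + h ^ 4 + h ^ 2 * ‖v‖ ^ 2) +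
      inner ℝ (cross eh (W + α • cross Mh W)) v := by
  set z := ‖cross mh v‖ with hz
  have hz0 : 0 ≤ z := norm_nonneg _
  have hE0 := norm_nonneg eh
  have hA0 := norm_nonneg a
  have hV0 := norm_nonneg v
  have b1 : ‖cross mh (cross mh v)‖ ≤ 5 * z :=
    (norm_cross_le _ _).trans (by gcongr)
  have b2 : ‖cross eh W‖ ≤ ‖eh‖ * K := (norm_cross_le _ _).trans (by gcongr)
  have b3 : ‖cross eh (cross Mh W)‖ ≤ ‖eh‖ * (3 * K) :=
    (norm_cross_le _ _).trans (by gcongr; exact (norm_cross_le _ _).trans (by gcongr))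
  have b4 : ‖cross mh (cross eh W)‖ ≤ 5 * (‖eh‖ * K) :=
    (norm_cross_le _ _).trans (by gcongr)
  have hDn : ‖D‖ ≤ z * (1 + 5 * α) + ‖eh‖ * (K * (1 + 8 * α)) + K * h ^ 2 := by
    rw [hD]
    have c1 := norm_add_le (- cross mh v - α • cross mh (cross mh v) - cross eh W
      - α • (cross eh (cross Mh W) + cross mh (cross eh W))) τ
    have c2 := norm_sub_le (- cross mh v - α • cross mh (cross mh v) - cross eh W)
      (α • (cross eh (cross Mh W) + cross mh (cross eh W)))
    have c3 := norm_sub_le (- cross mh v - α • cross mh (cross mh v)) (cross eh W)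
    have c4 := norm_sub_le (- cross mh v) (α • cross mh (cross mh v))
    have c5 := norm_add_le (cross eh (cross Mh W)) (cross mh (cross eh W))
    rw [norm_smul, Real.norm_of_nonneg hα.le] at c2 c4
    rw [norm_neg, ← hz] at c4
    nlinarith [mul_le_mul_of_nonneg_left b1 hα.le,
      mul_le_mul_of_nonneg_left (c5.trans (add_le_add b3 b4)) hα.le]
  have t1 : inner ℝ D a ≤ (z * (1 + 5 * α) + ‖eh‖ * (K * (1 + 8 * α)) + K * h ^ 2) * ‖a‖ :=
    (real_inner_le_norm _ _).trans (by gcongr)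
  have t2 : inner ℝ D v = α * z ^ 2 - inner ℝ (cross eh (W + α • cross Mh W)) v
      + α * inner ℝ (cross eh W) (cross mh v) + inner ℝ τ v := by
    have e1 : inner ℝ (cross mh v) v = 0 := inner_cross_self_right _ _
    have e2 : inner ℝ (cross mh (cross mh v)) v = - z ^ 2 := by
      rw [inner_cross_left, real_inner_self_eq_norm_sq]
    have e3 : inner ℝ (cross mh (cross eh W)) v = - inner ℝ (cross eh W) (cross mh v) :=
      inner_cross_left _ _ _
    rw [hD]
    simp only [inner_add_left, inner_sub_left, inner_neg_left, real_inner_smul_left, e1, e2, e3,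
      cross_add_right, cross_smul_right]
    ring
  have t3 : |inner ℝ (cross eh W) (cross mh v)| ≤ ‖eh‖ * K * z :=
    (abs_real_inner_le_norm _ _).trans (by gcongr)
  have t4 : |inner ℝ τ v| ≤ 3 * (K * h ^ 3) * ‖v‖ + 3 * (K * h ^ 2) * (z + ‖eh‖ * ‖v‖) := by
    have f1 := normSq_mul_inner Mh τ v
    have f2 : ‖cross Mh v‖ ≤ z + ‖eh‖ * ‖v‖ := by
      rw [hM, cross_add_left]
      exact (norm_add_le _ _).trans (by gcongr; exact norm_cross_le _ _)
    have f3 : |inner ℝ Mh τ * inner ℝ Mh v| ≤ K * h ^ 3 * (3 * ‖v‖) := by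
      rw [abs_mul]
      gcongr
      exact (abs_real_inner_le_norm _ _).trans (by gcongr)
    have f4 : |inner ℝ (cross Mh τ) (cross Mh v)| ≤ 3 * (K * h ^ 2) * (z + ‖eh‖ * ‖v‖) := by
      refine (abs_real_inner_le_norm _ _).trans ?_
      gcongr
      exact (norm_cross_le _ _).trans (by gcongr)
    have f5 : |inner ℝ τ v| ≤ ‖Mh‖ ^ 2 * |inner ℝ τ v| := by
      have : 1 ≤ ‖Mh‖ ^ 2 := one_le_pow₀ hMh1
      nlinarith [abs_nonneg (inner ℝ τ v)]
    calc _ ≤ |‖Mh‖ ^ 2 * inner ℝ τ v| := by rwa [abs_mul, abs_of_nonneg (sq_nonneg ‖Mh‖)]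
      _ ≤ _ := by
        rw [f1]
        refine (abs_add_le _ _).trans ?_
        linarith
  rw [inner_sub_right, t2]
  have t3' := neg_le_of_abs_le t3
  have t4' := neg_le_of_abs_le t4
  have t3'' : - (α * (‖eh‖ * K * z)) ≤ α * inner ℝ (cross eh W) (cross mh v) := by
    have := mul_le_mul_of_nonneg_left t3' hα.le
    linarith
  have habs := absorb_into_dissipation (A := ‖a‖) (z := z) hα hK hh hh1 hE0 hV0
  linarith only [habs, t3'', t4', t1]

/-- Testing the difference operator with `a - Δ_h a`. -/
theorem energy_le_sum_inner {k : ℝ} (hk : 0 < k) (a b c : Grid d N) (D : Grid d N)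
    (hD : D = (1 / k) • ((3 / 2 : ℝ) • a - (2 : ℝ) • b + (1 / 2 : ℝ) • c)) :
    energy a + energy ((2 : ℝ) • a - b) - energy b - energy ((2 : ℝ) • b - c) ≤
      4 * k * (mesh N ^ d * ∑ I, inner ℝ (D I) (a I - lapH a I)) := by
  have hm : 0 ≤ mesh N := by unfold mesh; positivity
  have hsum : ∑ I, inner ℝ (D I) (a I - lapH a I) =
      ∑ I, (inner ℝ (D I) (a I) + ∑ i, inner ℝ (gradH D I i) (gradH a I i)) := by
    simp only [inner_sub_right, Finset.sum_sub_distrib, Finset.sum_add_distrib, sum_inner_lapH]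
    ring
  have key : ∀ x y z : Vec3, ‖x‖ ^ 2 + ‖(2 : ℝ) • x - y‖ ^ 2 - ‖y‖ ^ 2 - ‖(2 : ℝ) • y - z‖ ^ 2 ≤
      4 * k * inner ℝ ((1 / k) • ((3 / 2 : ℝ) • x - (2 : ℝ) • y + (1 / 2 : ℝ) • z)) x := by
    intro x y z
    rw [real_inner_smul_left, show 4 * k * (1 / k * inner ℝ
      ((3 / 2 : ℝ) • x - (2 : ℝ) • y + (1 / 2 : ℝ) • z) x) = 4 * inner ℝ
      ((3 / 2 : ℝ) • x - (2 : ℝ) • y + (1 / 2 : ℝ) • z) x by field_simp, bdf_identity]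
    nlinarith [sq_nonneg ‖x - (2 : ℝ) • y + z‖]
  rw [hsum]
  simp only [energy]
  rw [← mul_add, ← mul_sub, ← mul_sub, mul_left_comm]
  gcongr
  rw [← Finset.sum_add_distrib, ← Finset.sum_sub_distrib, ← Finset.sum_sub_distrib,
    Finset.mul_sum]
  refine Finset.sum_le_sum fun I _ => ?_
  have k1 := key (a I) (b I) (c I)
  have k2 := Finset.sum_le_sum fun i (_ : i ∈ Finset.univ) =>
    key (gradH a I i) (gradH b I i) (gradH c I i)
  simp only [Finset.sum_add_distrib, Finset.sum_sub_distrib, ← Finset.mul_sum] at k2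
  simp only [hD, gradH_sub, gradH_add, gradH_smul, Pi.sub_apply, Pi.smul_apply, Pi.add_apply]
  linarith

theorem gradH_cross (f g : Grid d N) (I : Fin d → Fin N) (i : Fin d) :
    gradH (fun J => cross (f J) (g J)) I i =
      cross (gradH f I i) (fwd g i I) + cross (f I) (gradH g I i) := by
  simp only [gradH, fwd, cross_smul_left, cross_smul_right, ← smul_add, cross_sub_left,
    cross_sub_right]
  congr 1; abel

theorem norm_gradH_le {K : ℝ} (hN : 0 < N) (f : Grid d N) (I : Fin d → Fin N) (i : Fin d)
    (h : ‖fwd f i I - f I‖ ≤ K * mesh N) : ‖gradH f I i‖ ≤ K := by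
  have := mesh_pos hN
  rw [gradH, norm_smul, Real.norm_of_nonneg (by positivity), one_div, inv_mul_le_iff₀ this]
  linarith

theorem energy_step {α K : ℝ} (hα : 0 < α) (hK : 0 ≤ K) (d : ℕ) :
    ∃ C, 0 ≤ C ∧ ∀ (N : ℕ) (k : ℝ) (a b c mh eh Mh W τ : Grid d N), 0 < N → 0 < k →
      Mh = mh + eh →
      (∀ I, (1 / k) • ((3 / 2 : ℝ) • a I - (2 : ℝ) • b I + (1 / 2 : ℝ) • c I) =
        - cross (mh I) (lapH a I) - α • cross (mh I) (cross (mh I) (lapH a I))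
        - cross (eh I) (W I)
        - α • (cross (eh I) (cross (Mh I) (W I)) + cross (mh I) (cross (eh I) (W I))) + τ I) →
      (∀ I, ‖mh I‖ ≤ 5) → (∀ I, ‖Mh I‖ ≤ 3) → (∀ I, 1 ≤ ‖Mh I‖) → (∀ I, ‖W I‖ ≤ K) →
      (∀ I i, ‖fwd W i I - W I‖ ≤ K * mesh N) → (∀ I i, ‖fwd Mh i I - Mh I‖ ≤ K * mesh N) →
      (∀ I, ‖τ I‖ ≤ K * mesh N ^ 2) → (∀ I, |inner ℝ (Mh I) (τ I)| ≤ K * mesh N ^ 3) →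
      energy a + energy ((2 : ℝ) • a - b) - energy b - energy ((2 : ℝ) • b - c) ≤
        C * k * (energy a + energy eh + mesh N ^ 4) := by
  set P := (1 + 5 * α) ^ 2 / α + α * K ^ 2 + 9 * K ^ 2 / α + K * (1 + 8 * α) + 7 * K with hP
  have hP0 : 0 ≤ P := by positivity
  set Q := K + α * (K * K + 3 * K) + α * (3 * K) with hQ
  have hQ0 : 0 ≤ Q := by positivity
  refine ⟨4 * (P + P * (4 * d) + Q * (1 + d)), by positivity, ?_⟩
  intro N k a b c mh eh Mh W τ hN hk hM hD hmh hMh hMh1 hW hWd hMd hτ hMτ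
  have hh := mesh_pos hN
  have hh1 : mesh N ≤ 1 := mesh_le_one
  set D : Grid d N := (1 / k) • ((3 / 2 : ℝ) • a - (2 : ℝ) • b + (1 / 2 : ℝ) • c) with hDdef
  refine (energy_le_sum_inner hk a b c D hDdef).trans ?_
  set Y : Grid d N := fun I => W I + α • cross (Mh I) (W I) with hYdef
  have hcell : ∀ I, inner ℝ (D I) (a I - lapH a I) ≤
      P * (‖a I‖ ^ 2 + ‖eh I‖ ^ 2 + mesh N ^ 4 + mesh N ^ 2 * ‖lapH a I‖ ^ 2) +
      inner ℝ (cross (eh I) (Y I)) (lapH a I) := fun I =>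
    inner_step_le hα hK hh hh1 (congrFun hM I) (hD I) (hmh I) (hMh I) (hMh1 I) (hW I) (hτ I)
      (hMτ I)
  have hY : ∀ I, ‖Y I‖ ≤ Q := by
    intro I
    have h1 : ‖cross (Mh I) (W I)‖ ≤ 3 * K :=
      (norm_cross_le _ _).trans (mul_le_mul (hMh I) (hW I) (norm_nonneg _) (by norm_num))
    calc _ ≤ ‖W I‖ + ‖α • cross (Mh I) (W I)‖ := norm_add_le _ _
      _ ≤ K + α * (3 * K) := by
        rw [norm_smul, Real.norm_of_nonneg hα.le]
        gcongr
        exact hW I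
      _ ≤ Q := by
        have : 0 ≤ α * (K * K + 3 * K) := by positivity
        rw [hQ]; linarith
  have hYd : ∀ I i, ‖gradH Y I i‖ ≤ Q := by
    intro I i
    have h0 : gradH Y I i = gradH W I i + α • gradH (fun J => cross (Mh J) (W J)) I i := by
      simp only [hYdef, gradH, fwd]; module
    have h1 : ‖gradH W I i‖ ≤ K := norm_gradH_le hN _ _ _ (hWd I i)
    have h2 : ‖gradH Mh I i‖ ≤ K := norm_gradH_le hN _ _ _ (hMd I i)
    have h3 : ‖gradH (fun J => cross (Mh J) (W J)) I i‖ ≤ K * K + 3 * K := by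
      rw [gradH_cross]
      refine (norm_add_le _ _).trans (add_le_add ?_ ?_)
      · exact (norm_cross_le _ _).trans (mul_le_mul h2 (hW _) (norm_nonneg _) hK)
      · exact (norm_cross_le _ _).trans (mul_le_mul (hMh I) h1 (norm_nonneg _) (by norm_num))
    rw [h0]
    refine (norm_add_le _ _).trans ?_
    rw [norm_smul, Real.norm_of_nonneg hα.le]
    have : 0 ≤ α * (3 * K) := by positivity
    have := mul_le_mul_of_nonneg_left h3 hα.le
    rw [hQ]; linarith
  have hparts : ∑ I, inner ℝ (cross (eh I) (Y I)) (lapH a I) ≤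
      Q * ∑ I, (∑ i, ‖gradH eh I i‖ ^ 2 + d * ‖eh I‖ ^ 2 + ∑ i, ‖gradH a I i‖ ^ 2) := by
    rw [sum_inner_lapH (fun I => cross (eh I) (Y I)) a, ← Finset.sum_neg_distrib, Finset.mul_sum]
    refine Finset.sum_le_sum fun I _ => ?_
    have h0 : ∑ i : Fin d, (‖gradH eh I i‖ ^ 2 + ‖eh I‖ ^ 2 + ‖gradH a I i‖ ^ 2) =
        ∑ i, ‖gradH eh I i‖ ^ 2 + d * ‖eh I‖ ^ 2 + ∑ i, ‖gradH a I i‖ ^ 2 := by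
      simp [Finset.sum_add_distrib]
    rw [← h0, ← Finset.sum_neg_distrib, Finset.mul_sum]
    refine Finset.sum_le_sum fun i _ => ?_
    have h1 : ‖gradH (fun J => cross (eh J) (Y J)) I i‖ ≤ Q * (‖gradH eh I i‖ + ‖eh I‖) := by
      rw [gradH_cross]
      refine (norm_add_le _ _).trans ?_
      have c1 : ‖cross (gradH eh I i) (fwd Y i I)‖ ≤ ‖gradH eh I i‖ * Q :=
        (norm_cross_le _ _).trans (by gcongr; exact hY _)
      have c2 : ‖cross (eh I) (gradH Y I i)‖ ≤ ‖eh I‖ * Q :=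
        (norm_cross_le _ _).trans (by gcongr; exact hYd _ _)
      linarith
    have h2 := neg_le_of_abs_le (abs_real_inner_le_norm
      (gradH (fun J => cross (eh J) (Y J)) I i) (gradH a I i))
    have h3 : ‖gradH (fun J => cross (eh J) (Y J)) I i‖ * ‖gradH a I i‖ ≤
        Q * ((‖gradH eh I i‖ + ‖eh I‖) * ‖gradH a I i‖) := by
      rw [← mul_assoc]; gcongr
    have h4 : (‖gradH eh I i‖ + ‖eh I‖) * ‖gradH a I i‖ ≤
        ‖gradH eh I i‖ ^ 2 + ‖eh I‖ ^ 2 + ‖gradH a I i‖ ^ 2 := by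
      nlinarith [sq_nonneg (‖gradH eh I i‖ - ‖gradH a I i‖ / 2),
        sq_nonneg (‖eh I‖ - ‖gradH a I i‖ / 2), sq_nonneg ‖gradH a I i‖]
    have h5 := mul_le_mul_of_nonneg_left h4 hQ0
    linarith
  have hinv := sum_sq_lapH_le hN a
  have hmd : 0 ≤ mesh N ^ d := by positivity
  have hone := mesh_pow_mul_card (d := d) hN
  have htot := Finset.sum_le_sum fun I (_ : I ∈ Finset.univ) => hcell I
  rw [Finset.sum_add_distrib, ← Finset.mul_sum] at htot
  simp only [Finset.sum_add_distrib] at htot hparts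
  rw [← Finset.mul_sum (f := fun I => ‖eh I‖ ^ 2)] at hparts
  have hc : ∑ _I : Fin d → Fin N, mesh N ^ 4 = mesh N ^ 4 * ∑ _I : Fin d → Fin N, (1 : ℝ) := by
    rw [Finset.mul_sum]; simp
  rw [hc] at htot
  simp only [energy, Finset.sum_add_distrib]
  set SA := ∑ I, ‖a I‖ ^ 2
  set SE := ∑ I, ‖eh I‖ ^ 2
  set GA := ∑ I, ∑ i, ‖gradH a I i‖ ^ 2
  set GE := ∑ I, ∑ i, ‖gradH eh I i‖ ^ 2
  set SV := ∑ I, mesh N ^ 2 * ‖lapH a I‖ ^ 2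
  set S1 := ∑ _I : Fin d → Fin N, (1 : ℝ)
  have nSA : 0 ≤ SA := by positivity
  have nSE : 0 ≤ SE := by positivity
  have nGA : 0 ≤ GA := by positivity
  have nGE : 0 ≤ GE := by positivity
  have nS1 : 0 ≤ S1 := by positivity
  have hd0 : (0 : ℝ) ≤ d := by positivity
  have h4 : 0 ≤ mesh N ^ 4 * S1 := by positivity
  have hfin : ∑ I, inner ℝ (D I) (a I - lapH a I) ≤
      (P + P * (4 * d) + Q * (1 + d)) * (SA + GA + (SE + GE) + mesh N ^ 4 * S1) := by
    have hPd := mul_le_mul_of_nonneg_left hinv hP0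
    have hGA : P * (4 * d * GA) ≤ P * (4 * d) * (SA + GA + (SE + GE) + mesh N ^ 4 * S1) := by
      rw [← mul_assoc]; gcongr; linarith
    have hP1 := mul_le_mul_of_nonneg_left (show SA + SE + mesh N ^ 4 * S1 ≤
      SA + GA + (SE + GE) + mesh N ^ 4 * S1 by linarith only [nGA, nGE]) hP0
    have hd1 := mul_le_mul_of_nonneg_left (show SE ≤
      SA + GA + (SE + GE) + mesh N ^ 4 * S1 by linarith only [nSA, nGA, nGE, h4]) hd0
    have hQ1 := mul_le_mul_of_nonneg_left (show GE + d * SE + GA ≤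
      (1 + d) * (SA + GA + (SE + GE) + mesh N ^ 4 * S1) by
        linarith only [hd1, nSA, nSE, h4]) hQ0
    linarith only [htot, hparts, hPd, hGA, hP1, hQ1]
  calc _ ≤ 4 * k * (mesh N ^ d * ((P + P * (4 * d) + Q * (1 + d)) *
        (SA + GA + (SE + GE) + mesh N ^ 4 * S1))) := by gcongr
    _ = 4 * (P + P * (4 * d) + Q * (1 + d)) * k * (mesh N ^ d * (SA + GA) +
        mesh N ^ d * (SE + GE) + mesh N ^ 4 * (mesh N ^ d * S1)) := by ring
    _ = _ := by rw [hone, mul_one]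

/-! ### Projection onto the sphere -/

theorem norm_sub_normalize_le {M a : Vec3} (hM : ‖M‖ = 1) (ha : ‖a‖ ≤ 1 / 2) :
    ‖M - (1 / ‖M - a‖) • (M - a)‖ ≤ 2 * ‖a‖ := by
  have h1 := abs_norm_sub_norm_le M (M - a)
  rw [hM, sub_sub_cancel] at h1
  have h2 := abs_le.mp h1
  have hr : 0 < ‖M - a‖ := by linarith
  have h3 : M - (1 / ‖M - a‖) • (M - a) = a + (1 - 1 / ‖M - a‖) • (M - a) := by module
  have h4 : ‖(1 - 1 / ‖M - a‖) • (M - a)‖ ≤ ‖a‖ := by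
    rw [norm_smul, Real.norm_eq_abs]
    calc _ = |(1 - 1 / ‖M - a‖) * ‖M - a‖| := by rw [abs_mul, abs_of_pos hr]
      _ = |1 - ‖M - a‖| := by rw [abs_sub_comm]; congr 1; field_simp
      _ ≤ _ := h1
  rw [h3]
  linarith [norm_add_le a ((1 - 1 / ‖M - a‖) • (M - a))]

theorem norm_sub_normalize_sub_le {M M' a a' : Vec3} (hM : ‖M‖ = 1) (hM' : ‖M'‖ = 1)
    (ha : ‖a‖ ≤ 1 / 2) (ha' : ‖a'‖ ≤ 1 / 2) :
    ‖(M' - (1 / ‖M' - a'‖) • (M' - a')) - (M - (1 / ‖M - a‖) • (M - a))‖ ≤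
      8 * ‖a' - a‖ + 6 * (‖M' - M‖ * ‖a'‖) := by
  have h1 := abs_le.mp (abs_norm_sub_norm_le M (M - a))
  have h1' := abs_le.mp (abs_norm_sub_norm_le M' (M' - a'))
  rw [hM, sub_sub_cancel] at h1
  rw [hM', sub_sub_cancel] at h1'
  set r := ‖M - a‖ with hr
  set r' := ‖M' - a'‖ with hr'
  have hr0 : 1 / 2 ≤ r := by linarith
  have hr0' : 1 / 2 ≤ r' := by linarith
  have hp : 0 < r := by linarith
  have hp' : 0 < r' := by linarith
  have hinv : 1 / r' ≤ 2 := by rw [div_le_iff₀ hp']; linarith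
  have hid : (M' - (1 / r') • (M' - a')) - (M - (1 / r) • (M - a)) =
      (1 / r') • (a' - a) + ((r' - 1) * (1 / r')) • (M' - M) -
        ((r - r') * (1 / r')) • ((1 / r) • (M - a)) := by
    have e1 : (r' - 1) * (1 / r') = 1 - 1 / r' := by field_simp
    have e2 : (r - r') * (1 / r') * (1 / r) = 1 / r' - 1 / r := by field_simp
    rw [smul_smul, e1, e2]; module
  have hunit : ‖(1 / r) • (M - a)‖ = 1 := by
    rw [norm_smul, Real.norm_of_nonneg (by positivity), ← hr]; field_simp
  have hdiff : |r - r'| ≤ 2 * (‖M' - M‖ * ‖a'‖) + 3 * ‖a' - a‖ := by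
    have hsq : r ^ 2 - r' ^ 2 = 2 * inner ℝ (M' - M) a' + 2 * inner ℝ M (a' - a) +
        inner ℝ (a - a') (a + a') := by
      rw [hr, hr', norm_sub_sq_real, norm_sub_sq_real, hM, hM']
      simp only [inner_sub_left, inner_sub_right, inner_add_right, real_inner_self_eq_norm_sq,
        real_inner_comm a a']
      ring
    have c1 := abs_real_inner_le_norm (M' - M) a'
    have c2 := abs_real_inner_le_norm M (a' - a)
    have c3 := abs_real_inner_le_norm (a - a') (a + a')
    rw [hM, one_mul] at c2
    have c4 : ‖a - a'‖ * ‖a + a'‖ ≤ ‖a' - a‖ * 1 := by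
      rw [norm_sub_rev]
      gcongr
      linarith [norm_add_le a a']
    have c5 : |r - r'| ≤ |r ^ 2 - r' ^ 2| := by
      rw [show r ^ 2 - r' ^ 2 = (r - r') * (r + r') by ring, abs_mul, abs_of_pos (by linarith :
        0 < r + r')]
      nlinarith [abs_nonneg (r - r')]
    rw [hsq] at c5
    refine c5.trans ?_
    refine (abs_add_le _ _).trans ?_
    have c6 := abs_add_le (2 * inner ℝ (M' - M) a') (2 * inner ℝ M (a' - a))
    rw [abs_mul, abs_mul, abs_two] at c6
    linarith
  have hr1 : |r' - 1| ≤ ‖a'‖ := by rw [abs_le]; constructor <;> linarith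
  rw [hid]
  have n1 : ‖(1 / r') • (a' - a)‖ ≤ 2 * ‖a' - a‖ := by
    rw [norm_smul, Real.norm_of_nonneg (by positivity)]; gcongr
  have n2 : ‖((r' - 1) * (1 / r')) • (M' - M)‖ ≤ ‖a'‖ * 2 * ‖M' - M‖ := by
    rw [norm_smul, Real.norm_eq_abs, abs_mul, abs_of_nonneg (by positivity : 0 ≤ 1 / r')]
    gcongr
  have n3 : ‖((r - r') * (1 / r')) • ((1 / r) • (M - a))‖ ≤
      (2 * (‖M' - M‖ * ‖a'‖) + 3 * ‖a' - a‖) * 2 := by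
    rw [norm_smul, hunit, Real.norm_eq_abs, abs_mul,
      abs_of_nonneg (by positivity : 0 ≤ 1 / r'), mul_one]
    gcongr
  have n4 := norm_sub_le ((1 / r') • (a' - a) + ((r' - 1) * (1 / r')) • (M' - M))
    (((r - r') * (1 / r')) • ((1 / r) • (M - a)))
  have n5 := norm_add_le ((1 / r') • (a' - a)) (((r' - 1) * (1 / r')) • (M' - M))
  linarith

theorem add_sq_le_two_mul (x y : ℝ) : (x + y) ^ 2 ≤ 2 * x ^ 2 + 2 * y ^ 2 := by
  nlinarith [sq_nonneg (x - y)]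

/-- Projection onto the sphere is Lipschitz in the discrete `H¹` norm near a smooth unit field. -/
theorem energy_projection_le {K : ℝ} (hK : 0 ≤ K) (hN : 0 < N) (M a e : Grid d N)
    (hM : ∀ I, ‖M I‖ = 1) (hMd : ∀ I i, ‖fwd M i I - M I‖ ≤ K * mesh N)
    (ha : ∀ I, ‖a I‖ ≤ 1 / 2)
    (he : ∀ I, e I = M I - (1 / ‖M I - a I‖) • (M I - a I)) :
    energy e ≤ (4 + 72 * K ^ 2 * d + 2 * (8 + 6 * K) ^ 2) * energy a := by
  have hh := mesh_pos hN
  have hh1 : mesh N ≤ 1 := mesh_le_one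
  unfold energy
  rw [mul_left_comm]
  have hp : 0 ≤ mesh N ^ d := by positivity
  refine mul_le_mul_of_nonneg_left ?_ hp
  rw [Finset.mul_sum]
  refine Finset.sum_le_sum fun I _ => ?_
  have h1 : ‖e I‖ ^ 2 ≤ 4 * ‖a I‖ ^ 2 := by
    have := norm_sub_normalize_le (hM I) (ha I)
    rw [← he] at this
    nlinarith [norm_nonneg (e I)]
  have h2 : ∀ i, ‖gradH e I i‖ ^ 2 ≤
      2 * (8 + 6 * K) ^ 2 * ‖gradH a I i‖ ^ 2 + 72 * K ^ 2 * ‖a I‖ ^ 2 := by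
    intro i
    have c1 : ‖fwd e i I - e I‖ ≤
        8 * ‖fwd a i I - a I‖ + 6 * (‖fwd M i I - M I‖ * ‖fwd a i I‖) := by
      have := norm_sub_normalize_sub_le (hM I) (hM (Function.update I i (nextIdx (I i))))
        (ha I) (ha (Function.update I i (nextIdx (I i))))
      rwa [← he, ← he] at this
    have c2 : fwd a i I - a I = mesh N • gradH a I i := by
      simp only [gradH, smul_smul]
      rw [mul_one_div_cancel hh.ne', one_smul]
    have c2' : fwd e i I - e I = mesh N • gradH e I i := by
      simp only [gradH, smul_smul]
      rw [mul_one_div_cancel hh.ne', one_smul]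
    have c3 : ‖fwd a i I‖ ≤ ‖a I‖ + ‖gradH a I i‖ := by
      have : fwd a i I = a I + mesh N • gradH a I i := by rw [← c2]; abel
      rw [this]
      refine (norm_add_le _ _).trans ?_
      rw [norm_smul, Real.norm_of_nonneg hh.le]
      nlinarith [norm_nonneg (gradH a I i)]
    rw [c2, c2', norm_smul, norm_smul, Real.norm_of_nonneg hh.le] at c1
    have c4 : ‖fwd M i I - M I‖ * ‖fwd a i I‖ ≤ K * mesh N * (‖a I‖ + ‖gradH a I i‖) :=
      mul_le_mul (hMd I i) c3 (norm_nonneg _) (by positivity)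
    have c5 : ‖gradH e I i‖ ≤ (8 + 6 * K) * ‖gradH a I i‖ + 6 * K * ‖a I‖ := by
      refine le_of_mul_le_mul_left ?_ hh
      linarith
    calc _ ≤ ((8 + 6 * K) * ‖gradH a I i‖ + 6 * K * ‖a I‖) ^ 2 := by gcongr
      _ ≤ _ := add_sq_le_two_mul _ _
      _ = _ := by ring
  have h3 := Finset.sum_le_sum fun i (_ : i ∈ Finset.univ) => h2 i
  simp only [Finset.sum_add_distrib, ← Finset.mul_sum, Finset.sum_const, Finset.card_univ,
    Fintype.card_fin, nsmul_eq_mul] at h3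
  have h4 : 0 ≤ ∑ i, ‖gradH a I i‖ ^ 2 := by positivity
  have h5 : 0 ≤ (4 + 72 * K ^ 2 * d) * ∑ i, ‖gradH a I i‖ ^ 2 := by positivity
  have h6 : 0 ≤ 2 * (8 + 6 * K) ^ 2 * ‖a I‖ ^ 2 := by positivity
  linarith

theorem energy_two_smul_sub_le (f g : Grid d N) :
    energy ((2 : ℝ) • f - g) ≤ 8 * energy f + 2 * energy g := by
  have hm : 0 ≤ mesh N := by unfold mesh; positivity
  have key : ∀ x y : Vec3, ‖(2 : ℝ) • x - y‖ ^ 2 ≤ 8 * ‖x‖ ^ 2 + 2 * ‖y‖ ^ 2 := by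
    intro x y
    have := norm_sub_sq_le ((2 : ℝ) • x) y
    rw [norm_smul, Real.norm_two] at this
    linarith
  unfold energy
  rw [mul_left_comm, mul_left_comm 2, ← mul_add]
  refine mul_le_mul_of_nonneg_left ?_ (by positivity)
  rw [Finset.mul_sum, Finset.mul_sum, ← Finset.sum_add_distrib]
  refine Finset.sum_le_sum fun I _ => ?_
  have h1 := key (f I) (g I)
  have h2 := Finset.sum_le_sum fun i (_ : i ∈ Finset.univ) => key (gradH f I i) (gradH g I i)
  simp only [Finset.sum_add_distrib, ← Finset.mul_sum] at h2
  simp only [gradH_sub, gradH_smul, Pi.sub_apply, Pi.smul_apply]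
  linarith

/-- The inverse inequality between the maximum norm and the discrete `L²` norm. -/
theorem mesh_pow_mul_sq_le_energy (hd : d ≤ 3) (f : Grid d N) (I : Fin d → Fin N) :
    mesh N ^ 3 * ‖f I‖ ^ 2 ≤ energy f := by
  have hm : 0 ≤ mesh N := by unfold mesh; positivity
  have hm1 : mesh N ≤ 1 := mesh_le_one
  unfold energy
  have h1 : mesh N ^ 3 ≤ mesh N ^ d := pow_le_pow_of_le_one hm hm1 hd
  refine mul_le_mul h1 ?_ (by positivity) (by positivity)
  have h2 : ‖f I‖ ^ 2 ≤ ‖f I‖ ^ 2 + ∑ i, ‖gradH f I i‖ ^ 2 :=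
    le_add_of_nonneg_right (by positivity)
  exact h2.trans (Finset.single_le_sum
    (f := fun I => ‖f I‖ ^ 2 + ∑ i, ‖gradH f I i‖ ^ 2) (fun _ _ => by positivity)
    (Finset.mem_univ I))

theorem norm_le_half_of_energy_le {Λ : ℝ} (hd : d ≤ 3) (hN : 0 < N) (hΛ : Λ * mesh N ≤ 1 / 4)
    (f : Grid d N) (hf : energy f ≤ Λ * mesh N ^ 4) (I : Fin d → Fin N) : ‖f I‖ ≤ 1 / 2 := by
  have hh := mesh_pos hN
  have h1 := (mesh_pow_mul_sq_le_energy hd f I).trans hf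
  have h2 : ‖f I‖ ^ 2 ≤ Λ * mesh N := by
    refine le_of_mul_le_mul_left ?_ (pow_pos hh 3)
    linarith
  nlinarith [norm_nonneg (f I)]

theorem norm_extrap_le {x y : Vec3} (hx : ‖x‖ = 1) (hy : ‖y‖ = 1) : ‖(2 : ℝ) • x - y‖ ≤ 3 := by
  have := norm_sub_le ((2 : ℝ) • x) y
  rw [norm_smul, Real.norm_two, hx, hy] at this
  linarith

theorem one_le_norm_extrap {x y : Vec3} (hx : ‖x‖ = 1) (hy : ‖y‖ = 1) :
    1 ≤ ‖(2 : ℝ) • x - y‖ := by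
  have := norm_sub_norm_le ((2 : ℝ) • x) y
  rw [norm_smul, Real.norm_two, hx, hy] at this
  linarith

/-- The component of the difference quotient along the extrapolated field is of higher order. -/
theorem inner_extrap_bdf {x y z : Vec3} (hx : ‖x‖ = 1) (hy : ‖y‖ = 1) (hz : ‖z‖ = 1) :
    inner ℝ ((2 : ℝ) • y - z) ((3 / 2 : ℝ) • x - (2 : ℝ) • y + (1 / 2 : ℝ) • z) =
      - (3 / 4) * ‖x - (2 : ℝ) • y + z‖ ^ 2 := by
  have h1 : inner ℝ x x = (1 : ℝ) := by rw [real_inner_self_eq_norm_sq, hx]; norm_num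
  have h2 : inner ℝ y y = (1 : ℝ) := by rw [real_inner_self_eq_norm_sq, hy]; norm_num
  have h3 : inner ℝ z z = (1 : ℝ) := by rw [real_inner_self_eq_norm_sq, hz]; norm_num
  rw [← real_inner_self_eq_norm_sq]
  simp only [inner_eq_coord, PiLp.add_apply, PiLp.sub_apply, PiLp.smul_apply, smul_eq_mul]
    at h1 h2 h3 ⊢
  linear_combination (3 / 4) * h1 - h2 + (1 / 4) * h3

/-! ### Stability of the scheme -/

theorem error_equation {α k : ℝ} {M0 M1 M2 t0 t1 t2 mh Mh W v τ : Vec3}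
    (hstep : (1 / k) • ((3 / 2 : ℝ) • t2 - (2 : ℝ) • t1 + (1 / 2 : ℝ) • t0) =
      - cross mh (W - v) - α • cross mh (cross mh (W - v)))
    (hτ : τ = (1 / k) • ((3 / 2 : ℝ) • M2 - (2 : ℝ) • M1 + (1 / 2 : ℝ) • M0) + cross Mh W +
      α • cross Mh (cross Mh W)) :
    (1 / k) • ((3 / 2 : ℝ) • (M2 - t2) - (2 : ℝ) • (M1 - t1) + (1 / 2 : ℝ) • (M0 - t0)) =
      - cross mh v - α • cross mh (cross mh v) - cross (Mh - mh) W
        - α • (cross (Mh - mh) (cross Mh W) + cross mh (cross (Mh - mh) W)) + τ := by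
  have h : (1 / k) • ((3 / 2 : ℝ) • (M2 - t2) - (2 : ℝ) • (M1 - t1) + (1 / 2 : ℝ) • (M0 - t0)) =
      (1 / k) • ((3 / 2 : ℝ) • M2 - (2 : ℝ) • M1 + (1 / 2 : ℝ) • M0) -
      (1 / k) • ((3 / 2 : ℝ) • t2 - (2 : ℝ) • t1 + (1 / 2 : ℝ) • t0) := by module
  rw [h, hstep, hτ]
  simp only [cross_sub_left, cross_sub_right]
  module

theorem gronwall_step {A C E F k x y z : ℝ} (hC : 0 ≤ C) (hk : 0 < k) (hCk : C * k ≤ 1 / 2)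
    (hF : 1 ≤ F) (hz : 0 ≤ z) (hx : x ≤ z) (hE : E ≤ 10 * (F * z))
    (hA : A ≤ z) (hxy : y - x ≤ C * k * (y + E + A)) :
    y ≤ z * Real.exp ((2 * C + 11 * C * F) * k) := by
  have hCk0 : 0 ≤ C * k := by positivity
  have h1 : (1 - C * k) * y ≤ z * (1 + 11 * F * (C * k)) := by
    have hb : E + A ≤ 11 * (F * z) := by nlinarith
    have := mul_le_mul_of_nonneg_left hb hCk0
    nlinarith
  have h2 : y ≤ (1 + 2 * (C * k)) * (z * (1 + 11 * F * (C * k))) := by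
    have hp : 0 ≤ z * (1 + 11 * F * (C * k)) := by positivity
    rcases le_or_gt y 0 with hy | hy
    · exact hy.trans (by positivity)
    · have h3 := mul_le_mul_of_nonneg_left h1 (by positivity : 0 ≤ 1 + 2 * (C * k))
      have h4 : 0 ≤ C * k * (1 - 2 * (C * k)) * y :=
        mul_nonneg (mul_nonneg hCk0 (by linarith)) hy.le
      linarith
  have h5 : 1 + 2 * (C * k) ≤ Real.exp (2 * C * k) := by
    have := Real.add_one_le_exp (2 * C * k); linarith
  have h6 : 1 + 11 * F * (C * k) ≤ Real.exp (11 * C * F * k) := by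
    have := Real.add_one_le_exp (11 * C * F * k); linarith
  have h7 : Real.exp ((2 * C + 11 * C * F) * k) =
      Real.exp (2 * C * k) * Real.exp (11 * C * F * k) := by
    rw [← Real.exp_add]; congr 1; ring
  rw [h7]
  calc y ≤ _ := h2
    _ ≤ Real.exp (2 * C * k) * (z * Real.exp (11 * C * F * k)) := by gcongr
    _ = _ := by ring

/-- The quantities of the exact grid functions `M` which enter the error estimate are bounded by
`K`, at all time levels up to the final time. -/
structure IsConsistent {d N : ℕ} (α T k K : ℝ) (M : ℕ → Grid d N) : Prop where
  unit : ∀ n : ℕ, n * k ≤ T → ∀ I, ‖M n I‖ = 1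
  lipschitz : ∀ n : ℕ, n * k ≤ T → ∀ I i, ‖fwd (M n) i I - M n I‖ ≤ K * mesh N
  lapH_le : ∀ n : ℕ, n * k ≤ T → ∀ I, ‖lapH (M n) I‖ ≤ K
  lapH_lipschitz : ∀ n : ℕ, n * k ≤ T → ∀ I i,
    ‖fwd (lapH (M n)) i I - lapH (M n) I‖ ≤ K * mesh N
  truncation : ∀ n : ℕ, ((n + 2 : ℕ) : ℝ) * k ≤ T → ∀ I,
    ‖(1 / k) • ((3 / 2 : ℝ) • M (n + 2) I - (2 : ℝ) • M (n + 1) I + (1 / 2 : ℝ) • M n I) +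
      cross (extrap M n I) (lapH (M (n + 2)) I) +
      α • cross (extrap M n I) (cross (extrap M n I) (lapH (M (n + 2)) I))‖ ≤ K * mesh N ^ 2
  normal : ∀ n : ℕ, ((n + 2 : ℕ) : ℝ) * k ≤ T → ∀ I,
    |inner ℝ (extrap M n I)
      ((1 / k) • ((3 / 2 : ℝ) • M (n + 2) I - (2 : ℝ) • M (n + 1) I + (1 / 2 : ℝ) • M n I))| ≤
      K * mesh N ^ 3

theorem energy_error_step {α T K : ℝ} (hα : 0 < α) (hK : 0 ≤ K) (d : ℕ) :
    ∃ C, 0 ≤ C ∧ ∀ (N : ℕ) (k : ℝ) (M mt m : ℕ → Grid d N) (n : ℕ), 0 < N → 0 < k →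
      IsConsistent α T k K M → IsSchemeSolution α T k mt m → ((n + 2 : ℕ) : ℝ) * k ≤ T →
      (∀ I, ‖(M n - m n) I‖ ≤ 1 / 2) → (∀ I, ‖(M (n + 1) - m (n + 1)) I‖ ≤ 1 / 2) →
      energy (M (n + 2) - mt (n + 2)) +
          energy ((2 : ℝ) • (M (n + 2) - mt (n + 2)) - (M (n + 1) - mt (n + 1))) -
          energy (M (n + 1) - mt (n + 1)) -
          energy ((2 : ℝ) • (M (n + 1) - mt (n + 1)) - (M n - mt n)) ≤
        C * k * (energy (M (n + 2) - mt (n + 2)) +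
          energy ((2 : ℝ) • (M (n + 1) - m (n + 1)) - (M n - m n)) + mesh N ^ 4) := by
  obtain ⟨C, hC, hstep⟩ := energy_step (K := 3 * K) hα (by positivity) d
  refine ⟨C, hC, ?_⟩
  intro N k M mt m n hN hk hM hs hn b0 b1
  have hh := mesh_pos hN
  have hKh : 0 ≤ K * mesh N := by positivity
  have hn1 : ((n + 1 : ℕ) : ℝ) * k ≤ T := by
    push_cast at hn ⊢; nlinarith
  have hn0 : (n : ℝ) * k ≤ T := by
    push_cast at hn; nlinarith
  have hm : ∀ j : ℕ, j * k ≤ T → (∀ I, ‖(M j - m j) I‖ ≤ 1 / 2) → ∀ I, ‖m j I‖ ≤ 3 / 2 := by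
    intro j hj hb I
    have h1 : m j I = M j I - (M j - m j) I := by simp
    rw [h1]
    have := norm_sub_le (M j I) ((M j - m j) I)
    rw [hM.unit j hj] at this
    linarith [hb I]
  set e : Grid d N := extrap (fun j => M j - m j) n with he
  have hMe : ∀ I, extrap M n I - extrap m n I = e I := by
    intro I
    simp only [he, extrap, Pi.sub_apply, Pi.smul_apply]; module
  exact hstep N k (M (n + 2) - mt (n + 2)) (M (n + 1) - mt (n + 1)) (M n - mt n)
    (extrap m n) e (extrap M n) (lapH (M (n + 2))) (fun I =>
      (1 / k) • ((3 / 2 : ℝ) • M (n + 2) I - (2 : ℝ) • M (n + 1) I + (1 / 2 : ℝ) • M n I) +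
      cross (extrap M n I) (lapH (M (n + 2)) I) +
      α • cross (extrap M n I) (cross (extrap M n I) (lapH (M (n + 2)) I)))
    hN hk (by funext I; simp [← hMe])
    (by
      intro I
      rw [← hMe]
      refine error_equation ?_ rfl
      have := hs.step n hn I
      rwa [show lapH (mt (n + 2)) I = lapH (M (n + 2)) I - lapH (M (n + 2) - mt (n + 2)) I by
        rw [lapH_sub]; abel] at this)
    (by
      intro I
      have c1 := hm _ hn1 b1 I
      have c0 := hm _ hn0 b0 I
      have := norm_sub_le ((2 : ℝ) • m (n + 1) I) (m n I)
      rw [norm_smul, Real.norm_two] at this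
      simp only [extrap, Pi.sub_apply, Pi.smul_apply]
      linarith)
    (fun I => norm_extrap_le (hM.unit _ hn1 I) (hM.unit _ hn0 I))
    (fun I => one_le_norm_extrap (hM.unit _ hn1 I) (hM.unit _ hn0 I))
    (fun I => (hM.lapH_le _ hn I).trans (by linarith))
    (fun I i => (hM.lapH_lipschitz _ hn I i).trans (by linarith))
    (by
      intro I i
      have c1 := hM.lipschitz _ hn1 I i
      have c0 := hM.lipschitz _ hn0 I i
      have e1 : fwd (extrap M n) i I - extrap M n I =
          (2 : ℝ) • (fwd (M (n + 1)) i I - M (n + 1) I) - (fwd (M n) i I - M n I) := by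
        simp only [extrap, fwd, Pi.sub_apply, Pi.smul_apply]; module
      have := norm_sub_le ((2 : ℝ) • (fwd (M (n + 1)) i I - M (n + 1) I))
        (fwd (M n) i I - M n I)
      rw [norm_smul, Real.norm_two] at this
      rw [e1]
      linarith)
    (fun I => (hM.truncation _ hn I).trans (by
      have : 0 ≤ K * mesh N ^ 2 := by positivity
      linarith))
    (by
      intro I
      have c := hM.normal _ hn I
      have e1 : ∀ x : Vec3, inner ℝ (extrap M n I) (cross (extrap M n I) x) = 0 := by
        intro x; rw [real_inner_comm]; exact inner_cross_self_left _ _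
      rw [inner_add_right, inner_add_right, real_inner_smul_right (r := α), e1, e1, mul_zero,
        add_zero, add_zero]
      refine c.trans ?_
      have : 0 ≤ K * mesh N ^ 3 := by positivity
      linarith)

/-- Convergence of the scheme on fine grids. -/
theorem exists_energy_error_le {α T K A₀ : ℝ} (hα : 0 < α) (hT : 0 < T) (hK : 0 ≤ K)
    (hA₀ : 0 ≤ A₀) {d : ℕ} (hd : d ≤ 3) :
    ∃ Λ h₀ : ℝ, 0 < Λ ∧ 0 < h₀ ∧ ∀ (N : ℕ) (k : ℝ) (M mt m : ℕ → Grid d N), 0 < N → 0 < k →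
      k ≤ K * mesh N → mesh N ≤ h₀ → IsConsistent α T k K M → IsSchemeSolution α T k mt m →
      (∀ l ≤ 1, energy (M l - m l) ≤ A₀ * mesh N ^ 4 ∧ energy (M l - mt l) ≤ A₀ * mesh N ^ 4) →
      ∀ n : ℕ, n * k ≤ T → energy (M n - m n) ≤ Λ * mesh N ^ 4 := by
  obtain ⟨C, hC, hstep⟩ := energy_error_step (T := T) hα hK d
  set F := 4 + 72 * K ^ 2 * d + 2 * (8 + 6 * K) ^ 2 with hF
  have hF1 : 1 ≤ F := by
    have : 0 ≤ 72 * K ^ 2 * d := by positivity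
    have : 0 ≤ 2 * (8 + 6 * K) ^ 2 := by positivity
    linarith
  have hF0 : 0 < F := by linarith
  set A := 11 * A₀ + 1 with hA
  have hA1 : 1 ≤ A := by linarith
  set B := 2 * C + 11 * C * F with hB
  have hB0 : 0 ≤ B := by positivity
  set Λ := F * A * Real.exp (B * T) with hΛ
  have hΛ0 : 0 < Λ := by positivity
  refine ⟨Λ, 1 / (4 * Λ + 2 * C * K + 2), hΛ0, by positivity, ?_⟩
  intro N k M mt m hN hk hkh hh0 hM hs hstart
  have hh := mesh_pos hN
  have h4 : 0 < mesh N ^ 4 := by positivity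
  rw [le_div_iff₀ (by positivity)] at hh0
  have hp1 : 0 ≤ C * K * mesh N := by positivity
  have hp2 : 0 ≤ Λ * mesh N := by positivity
  have hΛh : Λ * mesh N ≤ 1 / 4 := by linarith
  have hCk : C * k ≤ 1 / 2 := by
    have := mul_le_mul_of_nonneg_left hkh hC
    linarith
  set G : ℕ → ℝ := fun n => A * Real.exp (B * (n * k)) * mesh N ^ 4 with hG
  have hG0 : ∀ n, 0 ≤ G n := fun n => by positivity
  have hGle : ∀ n : ℕ, n * k ≤ T → F * G n ≤ Λ * mesh N ^ 4 := by
    intro n hn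
    have : Real.exp (B * (n * k)) ≤ Real.exp (B * T) := by gcongr
    calc F * G n = F * A * Real.exp (B * (n * k)) * mesh N ^ 4 := by simp only [hG]; ring
      _ ≤ _ := by rw [hΛ]; gcongr
  have hGA : ∀ n, A * mesh N ^ 4 ≤ G n := by
    intro n
    have : 1 ≤ Real.exp (B * (n * k)) := Real.one_le_exp (by positivity)
    calc A * mesh N ^ 4 = A * 1 * mesh N ^ 4 := by ring
      _ ≤ _ := by simp only [hG]; gcongr
  have hGF : ∀ n, G n ≤ F * G n := fun n => le_mul_of_one_le_left (hG0 n) hF1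
  have hGsucc : ∀ n : ℕ, G (n + 1) = G n * Real.exp (B * k) := by
    intro n
    simp only [hG]
    rw [mul_assoc A, mul_assoc A, mul_assoc A, mul_right_comm (Real.exp (B * (n * k))),
      ← Real.exp_add]
    push_cast
    ring_nf
  have hGmono : ∀ n, G n ≤ G (n + 1) := by
    intro n
    rw [hGsucc]
    exact le_mul_of_one_le_right (hG0 n) (Real.one_le_exp (by positivity))
  have hmono : ∀ n : ℕ, ((n + 1 : ℕ) : ℝ) * k ≤ T → (n : ℝ) * k ≤ T := by
    intro n hn
    push_cast at hn
    nlinarith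
  have hmain : ∀ n : ℕ, ((n + 1 : ℕ) : ℝ) * k ≤ T →
      energy (M (n + 1) - mt (n + 1)) +
        energy ((2 : ℝ) • (M (n + 1) - mt (n + 1)) - (M n - mt n)) ≤ G n ∧
      energy (M (n + 1) - m (n + 1)) ≤ F * G n ∧ energy (M n - m n) ≤ F * G n := by
    intro n
    induction n with
    | zero =>
      intro _
      have s0 := hstart 0 (by norm_num)
      have s1 := hstart 1 le_rfl
      have g0 := hGA 0
      have g1 := hGF 0
      have h0 : 0 ≤ A₀ * mesh N ^ 4 := by positivity
      have h1 : A * mesh N ^ 4 = 11 * (A₀ * mesh N ^ 4) + mesh N ^ 4 := by rw [hA]; ring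
      refine ⟨?_, ?_, ?_⟩
      · have := energy_two_smul_sub_le (M 1 - mt 1) (M 0 - mt 0)
        simp only [zero_add]
        linarith [s0.2, s1.2]
      · simp only [zero_add]; linarith [s1.1]
      · linarith [s0.1]
    | succ n ih =>
      intro hn
      have hn1 := hmono _ hn
      have hn0 := hmono _ hn1
      obtain ⟨i1, i2, i3⟩ := ih hn1
      have hsmall : ∀ f : Grid d N, energy f ≤ Λ * mesh N ^ 4 → ∀ I, ‖f I‖ ≤ 1 / 2 := fun f hf =>
        norm_le_half_of_energy_le hd hN hΛh f hf
      have b1 := hsmall _ (i2.trans (hGle n hn0))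
      have b0 := hsmall _ (i3.trans (hGle n hn0))
      have hee : energy ((2 : ℝ) • (M (n + 1) - m (n + 1)) - (M n - m n)) ≤ 10 * (F * G n) := by
        have := energy_two_smul_sub_le (M (n + 1) - m (n + 1)) (M n - m n)
        linarith
      have hone := hstep N k M mt m n hN hk hM hs hn b0 b1
      have hX : energy (M (n + 2) - mt (n + 2)) +
          energy ((2 : ℝ) • (M (n + 2) - mt (n + 2)) - (M (n + 1) - mt (n + 1))) ≤ G (n + 1) := by
        rw [hGsucc]
        refine gronwall_step (E := energy ((2 : ℝ) • (M (n + 1) - m (n + 1)) - (M n - m n)))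
          (A := mesh N ^ 4) hC hk hCk hF1 (hG0 n) i1 hee ?_ ?_
        · refine le_trans ?_ (hGA n)
          exact le_mul_of_one_le_left h4.le hA1
        · have p1 : 0 ≤ C * k * energy
              ((2 : ℝ) • (M (n + 2) - mt (n + 2)) - (M (n + 1) - mt (n + 1))) :=
            mul_nonneg (by positivity) (energy_nonneg _)
          linarith
      refine ⟨hX, ?_, i2.trans (by gcongr; exact hGmono n)⟩
      have hX1 : energy (M (n + 2) - mt (n + 2)) ≤ G (n + 1) :=
        (le_add_of_nonneg_right (energy_nonneg _)).trans hX
      refine (energy_projection_le hK hN (M (n + 2)) (M (n + 2) - mt (n + 2)) _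
        (hM.unit _ hn) (hM.lipschitz _ hn)
        (hsmall _ (hX1.trans ((hGF _).trans (hGle _ hn1)))) ?_).trans (by gcongr)
      intro I
      have := hs.projection n hn I
      simp only [Pi.sub_apply, sub_sub_cancel]
      rw [show n + 1 + 1 = n + 2 from rfl, this]
  intro n hn
  rcases n with _ | n
  · refine (hstart 0 (by norm_num)).1.trans ?_
    have := (hGA 0).trans ((hGF 0).trans (hGle 0 (by simpa using hT.le)))
    refine le_trans ?_ this
    gcongr
    linarith
  · exact (hmain n hn).2.1.trans (hGle n (hmono n hn))

end Grid

/-! ### Taylor expansions -/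

section Taylor

variable {E : Type*} [NormedAddCommGroup E] [NormedSpace ℝ E]

theorem norm_sub_le_of_deriv_growth {S : Set ℝ} (hS : Convex ℝ S) {f f' : ℝ → E} {C a : ℝ} {n : ℕ}
    (hf : ∀ r ∈ S, HasDerivWithinAt f (f' r) S r) (hC : 0 ≤ C)
    (hb : ∀ r ∈ S, ‖f' r‖ ≤ C * |r - a| ^ n) (ha : a ∈ S) {s : ℝ} (hs : s ∈ S) :
    ‖f s - f a‖ ≤ C * |s - a| ^ (n + 1) := by
  have hsub : uIcc a s ⊆ S := by
    rw [← segment_eq_uIcc]; exact hS.segment_subset ha hs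
  have h := Convex.norm_image_sub_le_of_norm_hasDerivWithin_le (f := f) (f' := f')
    (C := C * |s - a| ^ n) (s := uIcc a s) (fun r hr => (hf r (hsub hr)).mono hsub)
    (fun r hr => (hb r (hsub hr)).trans (by
      gcongr ?_ * ?_ ^ n
      exact abs_sub_left_of_mem_uIcc hr)) (convex_uIcc a s) left_mem_uIcc right_mem_uIcc
  rwa [Real.norm_eq_abs, mul_assoc, ← pow_succ] at h

theorem hasDerivWithinAt_sq_half (a r : ℝ) (S : Set ℝ) :
    HasDerivWithinAt (fun r => (r - a) ^ 2 / 2) (r - a) S r :=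
  ((((hasDerivWithinAt_id r S).sub_const a).pow 2).div_const 2).congr_deriv (by simp)

theorem hasDerivWithinAt_cube_sixth (a r : ℝ) (S : Set ℝ) :
    HasDerivWithinAt (fun r => (r - a) ^ 3 / 6) ((r - a) ^ 2 / 2) S r :=
  ((((hasDerivWithinAt_id r S).sub_const a).pow 3).div_const 6).congr_deriv (by simp; ring)

theorem taylor_two {S : Set ℝ} (hS : Convex ℝ S) {f f1 f2 : ℝ → E} {C a : ℝ}
    (h0 : ∀ r ∈ S, HasDerivWithinAt f (f1 r) S r) (h1 : ∀ r ∈ S, HasDerivWithinAt f1 (f2 r) S r)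
    (hC : 0 ≤ C) (hb : ∀ r ∈ S, ‖f2 r‖ ≤ C) (ha : a ∈ S) {s : ℝ} (hs : s ∈ S) :
    ‖f s - f a - (s - a) • f1 a‖ ≤ C * |s - a| ^ 2 := by
  have hd : ∀ r ∈ S, HasDerivWithinAt (fun r => f r - f a - (r - a) • f1 a) (f1 r - f1 a) S r := by
    intro r hr
    have := ((h0 r hr).sub_const (f a)).sub (((hasDerivWithinAt_id r S).sub_const a).smul_const
      (f1 a))
    exact this.congr_deriv (by simp)
  have := norm_sub_le_of_deriv_growth hS hd hC (n := 1) (a := a) (fun r hr =>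
    norm_sub_le_of_deriv_growth hS h1 hC (n := 0) (fun r hr => by simpa using hb r hr) ha hr) ha hs
  simpa using this

theorem taylor_three {S : Set ℝ} (hS : Convex ℝ S) {f f1 f2 f3 : ℝ → E} {C a : ℝ}
    (h0 : ∀ r ∈ S, HasDerivWithinAt f (f1 r) S r) (h1 : ∀ r ∈ S, HasDerivWithinAt f1 (f2 r) S r)
    (h2 : ∀ r ∈ S, HasDerivWithinAt f2 (f3 r) S r)
    (hC : 0 ≤ C) (hb : ∀ r ∈ S, ‖f3 r‖ ≤ C) (ha : a ∈ S) {s : ℝ} (hs : s ∈ S) :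
    ‖f s - f a - (s - a) • f1 a - ((s - a) ^ 2 / 2) • f2 a‖ ≤ C * |s - a| ^ 3 := by
  have hd : ∀ r ∈ S, HasDerivWithinAt
      (fun r => f r - f a - (r - a) • f1 a - ((r - a) ^ 2 / 2) • f2 a)
      (f1 r - f1 a - (r - a) • f2 a) S r := by
    intro r hr
    have hid := (hasDerivWithinAt_id r S).sub_const a
    have := (((h0 r hr).sub_const (f a)).sub (hid.smul_const (f1 a))).sub
      ((hasDerivWithinAt_sq_half a r S).smul_const (f2 a))
    exact this.congr_deriv (by simp)
  have := norm_sub_le_of_deriv_growth hS hd hC (n := 2) (a := a) (fun r hr =>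
    taylor_two hS h1 h2 hC hb ha hr) ha hs
  simpa using this

theorem taylor_four {S : Set ℝ} (hS : Convex ℝ S) {f f1 f2 f3 f4 : ℝ → E} {C a : ℝ}
    (h0 : ∀ r ∈ S, HasDerivWithinAt f (f1 r) S r) (h1 : ∀ r ∈ S, HasDerivWithinAt f1 (f2 r) S r)
    (h2 : ∀ r ∈ S, HasDerivWithinAt f2 (f3 r) S r) (h3 : ∀ r ∈ S, HasDerivWithinAt f3 (f4 r) S r)
    (hC : 0 ≤ C) (hb : ∀ r ∈ S, ‖f4 r‖ ≤ C) (ha : a ∈ S) {s : ℝ} (hs : s ∈ S) :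
    ‖f s - f a - (s - a) • f1 a - ((s - a) ^ 2 / 2) • f2 a - ((s - a) ^ 3 / 6) • f3 a‖ ≤
      C * |s - a| ^ 4 := by
  have hd : ∀ r ∈ S, HasDerivWithinAt
      (fun r => f r - f a - (r - a) • f1 a - ((r - a) ^ 2 / 2) • f2 a - ((r - a) ^ 3 / 6) • f3 a)
      (f1 r - f1 a - (r - a) • f2 a - ((r - a) ^ 2 / 2) • f3 a) S r := by
    intro r hr
    have hid := (hasDerivWithinAt_id r S).sub_const a
    have := ((((h0 r hr).sub_const (f a)).sub (hid.smul_const (f1 a))).sub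
      ((hasDerivWithinAt_sq_half a r S).smul_const (f2 a))).sub
      ((hasDerivWithinAt_cube_sixth a r S).smul_const (f3 a))
    exact this.congr_deriv (by simp)
  have := norm_sub_le_of_deriv_growth hS hd hC (n := 3) (a := a) (fun r hr =>
    taylor_three hS h1 h2 h3 hC hb ha hr) ha hs
  simpa using this

/-- Second order consistency of the central second difference at an interior point. -/
theorem second_difference_interior {S : Set ℝ} (hS : Convex ℝ S) {f f1 f2 f3 f4 : ℝ → E} {C a h : ℝ}
    (h0 : ∀ r ∈ S, HasDerivWithinAt f (f1 r) S r) (h1 : ∀ r ∈ S, HasDerivWithinAt f1 (f2 r) S r)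
    (h2 : ∀ r ∈ S, HasDerivWithinAt f2 (f3 r) S r) (h3 : ∀ r ∈ S, HasDerivWithinAt f3 (f4 r) S r)
    (hC : 0 ≤ C) (hb : ∀ r ∈ S, ‖f4 r‖ ≤ C) (ha : a ∈ S) (hap : a + h ∈ S) (ham : a - h ∈ S) :
    ‖f (a + h) - (2 : ℝ) • f a + f (a - h) - h ^ 2 • f2 a‖ ≤ 6 * C * h ^ 4 := by
  have e1 := taylor_four hS h0 h1 h2 h3 hC hb ha hap
  have e2 := taylor_four hS h0 h1 h2 h3 hC hb ha ham
  have i1 : |a + h - a| ^ 4 = h ^ 4 := by rw [add_sub_cancel_left, Even.pow_abs (by decide)]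
  have i2 : |a - h - a| ^ 4 = h ^ 4 := by
    rw [sub_sub_cancel_left, abs_neg, Even.pow_abs (by decide)]
  rw [i1] at e1
  rw [i2] at e2
  have e3 := norm_add_le
    (f (a + h) - f a - (a + h - a) • f1 a - ((a + h - a) ^ 2 / 2) • f2 a -
      ((a + h - a) ^ 3 / 6) • f3 a)
    (f (a - h) - f a - (a - h - a) • f1 a - ((a - h - a) ^ 2 / 2) • f2 a -
      ((a - h - a) ^ 3 / 6) • f3 a)
  have e4 : f (a + h) - (2 : ℝ) • f a + f (a - h) - h ^ 2 • f2 a =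
    (f (a + h) - f a - (a + h - a) • f1 a - ((a + h - a) ^ 2 / 2) • f2 a -
      ((a + h - a) ^ 3 / 6) • f3 a) +
    (f (a - h) - f a - (a - h - a) • f1 a - ((a - h - a) ^ 2 / 2) • f2 a -
      ((a - h - a) ^ 3 / 6) • f3 a) := by module
  rw [e4]
  have : 0 ≤ C * h ^ 4 := by positivity
  linarith

/-- Second order consistency of the reflected second difference next to a boundary point `c` where
the odd derivatives vanish. The mesh size `h` is signed. -/
theorem second_difference_boundary {S : Set ℝ} (hS : Convex ℝ S) {f f1 f2 f3 f4 : ℝ → E} {C c h : ℝ}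
    (h0 : ∀ r ∈ S, HasDerivWithinAt f (f1 r) S r) (h1 : ∀ r ∈ S, HasDerivWithinAt f1 (f2 r) S r)
    (h2 : ∀ r ∈ S, HasDerivWithinAt f2 (f3 r) S r) (h3 : ∀ r ∈ S, HasDerivWithinAt f3 (f4 r) S r)
    (hC : 0 ≤ C) (hb : ∀ r ∈ S, ‖f4 r‖ ≤ C) (hc : c ∈ S) (hp : c + h / 2 ∈ S)
    (hq : c + 3 * h / 2 ∈ S) (hf1 : f1 c = 0) (hf3 : f3 c = 0) :
    ‖f (c + 3 * h / 2) - f (c + h / 2) - h ^ 2 • f2 (c + h / 2)‖ ≤ 6 * C * h ^ 4 := by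
  have e1 := taylor_four hS h0 h1 h2 h3 hC hb hc hp
  have e2 := taylor_four hS h0 h1 h2 h3 hC hb hc hq
  have e3 := taylor_two hS h2 h3 hC hb hc hp
  simp only [hf1, hf3, smul_zero, sub_zero, add_sub_cancel_left] at e1 e2 e3
  rw [Even.pow_abs (by decide)] at e1 e2
  rw [sq_abs] at e3
  have e4 : f (c + 3 * h / 2) - f (c + h / 2) - h ^ 2 • f2 (c + h / 2) =
      (f (c + 3 * h / 2) - f c - ((3 * h / 2) ^ 2 / 2) • f2 c) -
      (f (c + h / 2) - f c - ((h / 2) ^ 2 / 2) • f2 c) - h ^ 2 • (f2 (c + h / 2) - f2 c) := by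
    module
  rw [e4]
  have n1 := norm_sub_le ((f (c + 3 * h / 2) - f c - ((3 * h / 2) ^ 2 / 2) • f2 c) -
      (f (c + h / 2) - f c - ((h / 2) ^ 2 / 2) • f2 c)) (h ^ 2 • (f2 (c + h / 2) - f2 c))
  have n2 := norm_sub_le (f (c + 3 * h / 2) - f c - ((3 * h / 2) ^ 2 / 2) • f2 c)
      (f (c + h / 2) - f c - ((h / 2) ^ 2 / 2) • f2 c)
  have n3 : ‖h ^ 2 • (f2 (c + h / 2) - f2 c)‖ ≤ h ^ 2 * (C * (h / 2) ^ 2) := by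
    rw [norm_smul, Real.norm_of_nonneg (sq_nonneg h)]
    gcongr
  have : 0 ≤ C * h ^ 4 := by positivity
  linarith

/-- Backward difference formula and second difference for a function with bounded third
derivative. -/
theorem bdf_consistency {S : Set ℝ} (hS : Convex ℝ S) {f f1 f2 f3 : ℝ → E} {C t k : ℝ}
    (h0 : ∀ r ∈ S, HasDerivWithinAt f (f1 r) S r) (h1 : ∀ r ∈ S, HasDerivWithinAt f1 (f2 r) S r)
    (h2 : ∀ r ∈ S, HasDerivWithinAt f2 (f3 r) S r)
    (hC : 0 ≤ C) (hb : ∀ r ∈ S, ‖f3 r‖ ≤ C) (hk : 0 ≤ k) (ht : t ∈ S) (ht1 : t - k ∈ S)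
    (ht2 : t - 2 * k ∈ S) :
    ‖(3 / 2 : ℝ) • f t - (2 : ℝ) • f (t - k) + (1 / 2 : ℝ) • f (t - 2 * k) - k • f1 t‖ ≤
      6 * C * k ^ 3 := by
  have e1 := taylor_three hS h0 h1 h2 hC hb ht ht1
  have e2 := taylor_three hS h0 h1 h2 hC hb ht ht2
  simp only [sub_sub_cancel_left, abs_neg, abs_of_nonneg hk,
    abs_of_nonneg (by positivity : 0 ≤ 2 * k)] at e1 e2
  have e4 : (3 / 2 : ℝ) • f t - (2 : ℝ) • f (t - k) + (1 / 2 : ℝ) • f (t - 2 * k) - k • f1 t =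
      (1 / 2 : ℝ) • (f (t - 2 * k) - f t - (-(2 * k)) • f1 t - ((-(2 * k)) ^ 2 / 2) • f2 t) -
      (2 : ℝ) • (f (t - k) - f t - (-k) • f1 t - ((-k) ^ 2 / 2) • f2 t) := by module
  rw [e4]
  refine (norm_sub_le _ _).trans ?_
  rw [norm_smul, norm_smul, Real.norm_two, Real.norm_of_nonneg (by norm_num : (0 : ℝ) ≤ 1 / 2)]
  linarith

theorem second_difference_le {S : Set ℝ} (hS : Convex ℝ S) {f f1 f2 : ℝ → E} {C t k : ℝ}
    (h0 : ∀ r ∈ S, HasDerivWithinAt f (f1 r) S r) (h1 : ∀ r ∈ S, HasDerivWithinAt f1 (f2 r) S r)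
    (hC : 0 ≤ C) (hb : ∀ r ∈ S, ‖f2 r‖ ≤ C) (ht : t ∈ S) (ht1 : t - k ∈ S)
    (ht2 : t - 2 * k ∈ S) :
    ‖f t - (2 : ℝ) • f (t - k) + f (t - 2 * k)‖ ≤ 6 * C * k ^ 2 := by
  have e1 := taylor_two hS h0 h1 hC hb ht ht1
  have e2 := taylor_two hS h0 h1 hC hb ht ht2
  rw [sq_abs] at e1 e2
  have e4 : f t - (2 : ℝ) • f (t - k) + f (t - 2 * k) =
      (f (t - 2 * k) - f t - (t - 2 * k - t) • f1 t) -
      (2 : ℝ) • (f (t - k) - f t - (t - k - t) • f1 t) := by module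
  rw [e4]
  refine (norm_sub_le _ _).trans ?_
  rw [norm_smul, Real.norm_two]
  linarith

end Taylor

/-! ### Partial derivatives on the closed cube -/

section Cube

variable {d : ℕ} {E : Type*} [NormedAddCommGroup E] [NormedSpace ℝ E]

theorem convex_cube (d : ℕ) : Convex ℝ (cube d) := by
  intro x hx y hy a b ha hb hab i
  exact convex_Icc (0 : ℝ) 1 (hx i) (hy i) ha hb hab

theorem interior_cube_nonempty (d : ℕ) : (interior (cube d)).Nonempty := by
  have ho : IsOpen {x : Space d | ∀ i, x i ∈ Ioo (0 : ℝ) 1} := by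
    simp only [ofPred_forall]
    exact isOpen_iInter_of_finite fun i =>
      isOpen_Ioo.preimage (by fun_prop : Continuous fun x : Space d => x i)
  refine ⟨WithLp.toLp 2 fun _ => (1 / 2 : ℝ), ?_⟩
  refine interior_maximal (t := {x : Space d | ∀ i, x i ∈ Ioo (0 : ℝ) 1})
    (fun x hx i => Ioo_subset_Icc_self (hx i)) ho ?_
  intro i
  norm_num

theorem uniqueDiffOn_cube (d : ℕ) : UniqueDiffOn ℝ (cube d) :=
  uniqueDiffOn_convex (convex_cube d) (interior_cube_nonempty d)

theorem subset_closure_interior_cube (d : ℕ) : cube d ⊆ closure (interior (cube d)) := by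
  rw [(convex_cube d).closure_interior_eq_closure_of_nonempty_interior (interior_cube_nonempty d)]
  exact subset_closure

/-- The partial derivative in direction `i`, up to the boundary of the cube. -/
noncomputable def partialD (i : Fin d) (f : Space d → E) (x : Space d) : E :=
  fderivWithin ℝ f (cube d) x (EuclideanSpace.single i 1)

/-- The point `x` with its `i`-th coordinate replaced by `s`. -/
noncomputable def setCoord (x : Space d) (i : Fin d) (s : ℝ) : Space d :=
  x + (s - x i) • EuclideanSpace.single i (1 : ℝ)

theorem setCoord_apply_self (x : Space d) (i : Fin d) (s : ℝ) : setCoord x i s i = s := by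
  simp [setCoord]

theorem setCoord_apply_of_ne (x : Space d) {i j : Fin d} (h : j ≠ i) (s : ℝ) :
    setCoord x i s j = x j := by
  simp [setCoord, h]

theorem setCoord_self (x : Space d) (i : Fin d) : setCoord x i (x i) = x := by
  simp [setCoord]

theorem setCoord_mem_cube {x : Space d} (hx : x ∈ cube d) (i : Fin d) {s : ℝ}
    (hs : s ∈ Icc (0 : ℝ) 1) : setCoord x i s ∈ cube d := by
  intro j
  by_cases h : j = i
  · subst h; rwa [setCoord_apply_self]
  · rw [setCoord_apply_of_ne x h]; exact hx j

theorem hasDerivWithinAt_partialD {f : Space d → E} (hf : DifferentiableOn ℝ f (cube d))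
    {x : Space d} (hx : x ∈ cube d) (i : Fin d) {s : ℝ} (hs : s ∈ Icc (0 : ℝ) 1) :
    HasDerivWithinAt (fun s => f (setCoord x i s)) (partialD i f (setCoord x i s))
      (Icc (0 : ℝ) 1) s := by
  have h1 := (hf _ (setCoord_mem_cube hx i hs)).hasFDerivWithinAt
  have h2 : HasDerivWithinAt (setCoord x i) (EuclideanSpace.single i (1 : ℝ)) (Icc (0 : ℝ) 1) s := by
    have := (((hasDerivWithinAt_id s (Icc (0 : ℝ) 1)).sub_const (x i)).smul_const
      (EuclideanSpace.single i (1 : ℝ))).const_add x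
    exact this.congr_deriv (one_smul _ _)
  exact h1.comp_hasDerivWithinAt s h2 fun r hr => setCoord_mem_cube hx i hr

theorem partialD_eq_of_hasDerivWithinAt {f : Space d → E} (hf : DifferentiableOn ℝ f (cube d))
    {x : Space d} (hx : x ∈ cube d) (i : Fin d) {v : E}
    (hv : HasDerivWithinAt (fun s => f (setCoord x i s)) v (Icc (0 : ℝ) 1) (x i)) :
    partialD i f x = v := by
  have h := hasDerivWithinAt_partialD hf hx i (hx i)
  rw [setCoord_self] at h
  exact (uniqueDiffOn_Icc_zero_one _ (hx i)).eq_deriv _ h hv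

/-- `f` is `n` times continuously differentiable on the closed cube with derivatives bounded
by `M`. -/
def BoundedDerivs (n : ℕ) (M : ℝ) (f : Space d → E) : Prop :=
  ContDiffOn ℝ n f (cube d) ∧ ∀ j ≤ n, ∀ x ∈ cube d, ‖iteratedFDerivWithin ℝ j f (cube d) x‖ ≤ M

theorem BoundedDerivs.norm_le {n : ℕ} {M : ℝ} {f : Space d → E} (hf : BoundedDerivs n M f)
    {x : Space d} (hx : x ∈ cube d) : ‖f x‖ ≤ M := by
  have := hf.2 0 (Nat.zero_le _) x hx
  rwa [norm_iteratedFDerivWithin_zero] at this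

theorem contDiffOn_partialD {n : ℕ} {f : Space d → E} (hf : ContDiffOn ℝ (n + 1 : ℕ) f (cube d))
    (i : Fin d) : ContDiffOn ℝ n (partialD i f) (cube d) :=
  (hf.fderivWithin (uniqueDiffOn_cube d) (by norm_cast)).clm_apply contDiffOn_const

theorem BoundedDerivs.partialD {n : ℕ} {M : ℝ} {f : Space d → E} (hf : BoundedDerivs (n + 1) M f)
    (i : Fin d) : BoundedDerivs n M (partialD i f) := by
  refine ⟨contDiffOn_partialD hf.1 i, fun j hj x hx => ?_⟩
  have hd : ContDiffOn ℝ n (fderivWithin ℝ f (cube d)) (cube d) :=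
    hf.1.fderivWithin (uniqueDiffOn_cube d) (by norm_cast)
  set L : (Space d →L[ℝ] E) →L[ℝ] E :=
    ContinuousLinearMap.apply ℝ E (EuclideanSpace.single i (1 : ℝ)) with hL
  have hL1 : ‖L‖ ≤ 1 := by
    refine ContinuousLinearMap.opNorm_le_bound _ zero_le_one fun A => ?_
    have := A.le_opNorm (EuclideanSpace.single i (1 : ℝ))
    simpa [hL] using this
  have h1 := L.norm_iteratedFDerivWithin_comp_left (hd x hx) (uniqueDiffOn_cube d) hx
    (n := j) (by exact_mod_cast hj)
  rw [norm_iteratedFDerivWithin_fderivWithin (uniqueDiffOn_cube d) hx] at h1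
  have h2 := hf.2 (j + 1) (by omega) x hx
  have h3 : LandauLifshitz.partialD i f = L ∘ fderivWithin ℝ f (cube d) := rfl
  rw [h3]
  calc _ ≤ _ := h1
    _ ≤ 1 * M := by gcongr
    _ = M := one_mul M

theorem BoundedDerivs.differentiableOn {n : ℕ} {M : ℝ} {f : Space d → E}
    (hf : BoundedDerivs (n + 1) M f) : DifferentiableOn ℝ f (cube d) :=
  hf.1.differentiableOn (by norm_cast)

theorem BoundedDerivs.nonneg {n : ℕ} {M : ℝ} {f : Space d → E}
    (hf : BoundedDerivs n M f) : 0 ≤ M := by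
  obtain ⟨x, hx⟩ := interior_cube_nonempty d
  exact (norm_nonneg _).trans (hf.norm_le (interior_subset hx))

theorem partialD_comm {f : Space d → E} (hf : ContDiffOn ℝ 2 f (cube d)) (i j : Fin d)
    {x : Space d} (hx : x ∈ cube d) :
    partialD i (partialD j f) x = partialD j (partialD i f) x := by
  have hsymm : IsSymmSndFDerivWithinAt ℝ f (cube d) x :=
    (hf x hx).isSymmSndFDerivWithinAt (by simp) (uniqueDiffOn_cube d)
      (subset_closure_interior_cube d hx) hx
  have hd : DifferentiableWithinAt ℝ (fderivWithin ℝ f (cube d)) (cube d) x :=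
    (hf.fderivWithin (m := 1) (uniqueDiffOn_cube d) (by norm_num)).differentiableOn
      (by norm_num) x hx
  have key : ∀ i j : Fin d, partialD i (partialD j f) x =
      fderivWithin ℝ (fderivWithin ℝ f (cube d)) (cube d) x (EuclideanSpace.single i 1)
        (EuclideanSpace.single j 1) := by
    intro i j
    have := (hd.hasFDerivWithinAt.clm_apply
      (hasFDerivWithinAt_const (EuclideanSpace.single j (1 : ℝ)) x (cube d))).fderivWithin
      (uniqueDiffOn_cube d x hx)
    unfold partialD
    rw [this]
    simp
  rw [key, key, hsymm]

theorem partialD_congr {f g : Space d → E} (h : ∀ x ∈ cube d, f x = g x) (i : Fin d) {x : Space d}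
    (hx : x ∈ cube d) : partialD i f x = partialD i g x := by
  unfold partialD
  rw [fderivWithin_congr (fun y hy => h y hy) (h x hx)]

theorem laplacianWithin_eq_sum_partialD {f : Space d → E} (hf : ContDiffOn ℝ 2 f (cube d))
    {x : Space d} (hx : x ∈ cube d) :
    InnerProductSpace.laplacianWithin f (cube d) x = ∑ i, partialD i (partialD i f) x := by
  rw [InnerProductSpace.laplacianWithin_eq_iteratedFDerivWithin_orthonormalBasis f
    (uniqueDiffOn_cube d) hx (EuclideanSpace.basisFun (Fin d) ℝ)]
  refine Finset.sum_congr rfl fun i _ => ?_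
  have hd : DifferentiableWithinAt ℝ (fderivWithin ℝ f (cube d)) (cube d) x :=
    (hf.fderivWithin (m := 1) (uniqueDiffOn_cube d) (by norm_num)).differentiableOn
      (by norm_num) x hx
  rw [iteratedFDerivWithin_two_apply _ (uniqueDiffOn_cube d) hx]
  have := (hd.hasFDerivWithinAt.clm_apply
      (hasFDerivWithinAt_const (EuclideanSpace.single i (1 : ℝ)) x (cube d))).fderivWithin
      (uniqueDiffOn_cube d x hx)
  unfold partialD
  rw [this]
  simp

/-- A function vanishing on a face has vanishing tangential derivatives there. -/
theorem partialD_eq_zero_of_face {f : Space d → E} (hf : DifferentiableOn ℝ f (cube d))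
    {i j : Fin d} (hij : j ≠ i) {c : ℝ} (h : ∀ x ∈ cube d, x i = c → f x = 0) {x : Space d}
    (hx : x ∈ cube d) (hxc : x i = c) : partialD j f x = 0 := by
  refine partialD_eq_of_hasDerivWithinAt hf hx j ?_
  refine (hasDerivWithinAt_const (x j) (Icc (0 : ℝ) 1) (0 : E)).congr_of_mem (fun s hs => ?_) (hx j)
  exact h _ (setCoord_mem_cube hx j hs) (by rw [setCoord_apply_of_ne x hij.symm, hxc])

end Cube

/-! ### Consistency of the discrete Laplacian -/

section Consistency

variable {d N : ℕ}

theorem cell_mem_Icc (hN : 0 < N) (j : Fin N) : ((j : ℕ) + 1 / 2 : ℝ) * mesh N ∈ Icc (0 : ℝ) 1 := by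
  have hh := mesh_pos hN
  have hj : ((j : ℕ) : ℝ) + 1 ≤ N := by exact_mod_cast j.isLt
  have hNh : (N : ℝ) * mesh N = 1 := by
    unfold mesh; field_simp
  constructor
  · positivity
  · rw [← hNh]; gcongr; linarith

theorem gridPoint_mem_cube (hN : 0 < N) (I : Fin d → Fin N) : gridPoint d N I ∈ cube d :=
  fun i => cell_mem_Icc hN (I i)

theorem gridPoint_update (I : Fin d → Fin N) (i : Fin d) (j : Fin N) :
    gridPoint d N (Function.update I i j) =
      setCoord (gridPoint d N I) i (((j : ℕ) + 1 / 2) * mesh N) := by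
  ext l
  by_cases h : l = i
  · subst h; simp [setCoord_apply_self, gridPoint]
  · simp [setCoord_apply_of_ne _ h, gridPoint, h]

theorem natCast_mul_mesh (hN : 0 < N) : (N : ℝ) * mesh N = 1 := by
  unfold mesh; field_simp

theorem norm_second_difference_sub_le {M : ℝ} {f : Space d → Vec3} (hf : BoundedDerivs 4 M f)
    {i : Fin d} (h1 : ∀ x ∈ cube d, x i = 0 ∨ x i = 1 → partialD i f x = 0)
    (h3 : ∀ x ∈ cube d, x i = 0 ∨ x i = 1 → partialD i (partialD i (partialD i f)) x = 0)
    (hN : 2 ≤ N) (I : Fin d → Fin N) :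
    ‖fwd (restrictGrid d N f) i I - (2 : ℝ) • restrictGrid d N f I + bwd (restrictGrid d N f) i I -
      mesh N ^ 2 • partialD i (partialD i f) (gridPoint d N I)‖ ≤ 6 * M * mesh N ^ 4 := by
  have hN0 : 0 < N := by omega
  have hh := mesh_pos hN0
  have hNh := natCast_mul_mesh hN0
  set x := gridPoint d N I with hx
  have hxc : x ∈ cube d := gridPoint_mem_cube hN0 I
  set S := Icc (0 : ℝ) 1
  set a : ℝ := ((I i : ℕ) + 1 / 2) * mesh N with ha
  have hxa : x i = a := rfl
  have hM := hf.nonneg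
  have d0 : ∀ r ∈ S, HasDerivWithinAt (fun s => f (setCoord x i s))
      (partialD i f (setCoord x i r)) S r := fun r hr =>
    hasDerivWithinAt_partialD hf.differentiableOn hxc i hr
  have d1 : ∀ r ∈ S, HasDerivWithinAt (fun s => partialD i f (setCoord x i s))
      (partialD i (partialD i f) (setCoord x i r)) S r := fun r hr =>
    hasDerivWithinAt_partialD (hf.partialD i).differentiableOn hxc i hr
  have d2 : ∀ r ∈ S, HasDerivWithinAt (fun s => partialD i (partialD i f) (setCoord x i s))
      (partialD i (partialD i (partialD i f)) (setCoord x i r)) S r := fun r hr =>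
    hasDerivWithinAt_partialD ((hf.partialD i).partialD i).differentiableOn hxc i hr
  have d3 : ∀ r ∈ S, HasDerivWithinAt
      (fun s => partialD i (partialD i (partialD i f)) (setCoord x i s))
      (partialD i (partialD i (partialD i (partialD i f))) (setCoord x i r)) S r := fun r hr =>
    hasDerivWithinAt_partialD (((hf.partialD i).partialD i).partialD i).differentiableOn hxc i hr
  have hb : ∀ r ∈ S, ‖partialD i (partialD i (partialD i (partialD i f))) (setCoord x i r)‖ ≤ M :=
    fun r hr => ((((hf.partialD i).partialD i).partialD i).partialD i).norm_le
      (setCoord_mem_cube hxc i hr)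
  have hfwd : fwd (restrictGrid d N f) i I =
      f (setCoord x i (((nextIdx (I i) : ℕ) + 1 / 2) * mesh N)) := by
    simp only [fwd, restrictGrid, gridPoint_update, hx]
  have hbwd : bwd (restrictGrid d N f) i I =
      f (setCoord x i (((prevIdx (I i) : ℕ) + 1 / 2) * mesh N)) := by
    simp only [bwd, restrictGrid, gridPoint_update, hx]
  have hself : restrictGrid d N f I = f (setCoord x i a) := by
    rw [← hxa, setCoord_self]; rfl
  have hself' : partialD i (partialD i f) x = partialD i (partialD i f) (setCoord x i a) := by
    rw [← hxa, setCoord_self]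
  have hp := cell_mem_Icc hN0 (nextIdx (I i))
  have hm := cell_mem_Icc hN0 (prevIdx (I i))
  have hs := cell_mem_Icc hN0 (I i)
  rw [hfwd, hbwd, hself, hself']
  rcases Nat.eq_zero_or_pos (I i : ℕ) with h0 | h0
  · have e1 : ((nextIdx (I i) : ℕ) : ℝ) = 1 := by
      simp only [nextIdx, h0, zero_add]
      rw [dif_pos (by omega)]; simp
    have e2 : ((prevIdx (I i) : ℕ) : ℝ) = 0 := by simp [prevIdx, h0]
    have ea : a = 0 + mesh N / 2 := by rw [ha, h0]; push_cast; ring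
    have ep : (((nextIdx (I i) : ℕ) : ℝ) + 1 / 2) * mesh N = 0 + 3 * mesh N / 2 := by
      rw [e1]; ring
    have em : (((prevIdx (I i) : ℕ) : ℝ) + 1 / 2) * mesh N = a := by rw [e2, ea]; ring
    rw [em]
    rw [ep] at hp ⊢
    have h00 : (0 : ℝ) ∈ S := by simp [S]
    have hface := setCoord_apply_self x i 0
    have := second_difference_boundary (convex_Icc 0 1) d0 d1 d2 d3 hM hb h00
      (by rw [← ea]; exact hs) hp (h1 _ (setCoord_mem_cube hxc i h00) (Or.inl hface))
      (h3 _ (setCoord_mem_cube hxc i h00) (Or.inl hface))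
    rw [← ea] at this
    rwa [show ∀ u v w : Vec3, u - (2 : ℝ) • v + v - w = u - v - w from
      fun u v w => by module]
  · have e2 : ((prevIdx (I i) : ℕ) : ℝ) = (I i : ℕ) - 1 := by
      simp only [prevIdx]; rw [Nat.cast_sub h0]; simp
    have em : (((prevIdx (I i) : ℕ) : ℝ) + 1 / 2) * mesh N = a - mesh N := by rw [e2, ha]; ring
    rw [em] at hm ⊢
    by_cases hl : (I i : ℕ) + 1 < N
    · have e1 : ((nextIdx (I i) : ℕ) : ℝ) = (I i : ℕ) + 1 := by simp [nextIdx, hl]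
      have ep : (((nextIdx (I i) : ℕ) : ℝ) + 1 / 2) * mesh N = a + mesh N := by rw [e1, ha]; ring
      rw [ep] at hp ⊢
      have := second_difference_interior (convex_Icc 0 1) d0 d1 d2 d3 hM hb hs hp hm
      exact this
    · have e1 : nextIdx (I i) = I i := by simp [nextIdx, hl]
      have hlast : ((I i : ℕ) : ℝ) = N - 1 := by
        have h := (I i).isLt
        have h' : (I i : ℕ) + 1 = N := by omega
        have : ((I i : ℕ) : ℝ) + 1 = N := by exact_mod_cast h'
        linarith
      have ea : a = 1 + (-mesh N) / 2 := by rw [ha, hlast]; linarith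
      have ea' : a - mesh N = 1 + 3 * (-mesh N) / 2 := by rw [ea]; ring
      rw [e1]
      have h11 : (1 : ℝ) ∈ S := by simp [S]
      have hface := setCoord_apply_self x i 1
      have := second_difference_boundary (convex_Icc 0 1) d0 d1 d2 d3 hM hb h11
        (by rw [← ea]; exact hs) (by rw [← ea']; exact hm)
        (h1 _ (setCoord_mem_cube hxc i h11) (Or.inr hface))
        (h3 _ (setCoord_mem_cube hxc i h11) (Or.inr hface))
      rw [← ea, ← ea', neg_sq, Even.neg_pow (by decide)] at this
      rwa [show ∀ u v w : Vec3, v - (2 : ℝ) • v + u - w = u - v - w from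
        fun u v w => by module]

theorem norm_lapH_sub_le {M : ℝ} {f : Space d → Vec3} (hf : BoundedDerivs 4 M f)
    (h1 : ∀ i, ∀ x ∈ cube d, x i = 0 ∨ x i = 1 → partialD i f x = 0)
    (h3 : ∀ i, ∀ x ∈ cube d, x i = 0 ∨ x i = 1 → partialD i (partialD i (partialD i f)) x = 0)
    (hN : 2 ≤ N) (I : Fin d → Fin N) :
    ‖lapH (restrictGrid d N f) I - ∑ i, partialD i (partialD i f) (gridPoint d N I)‖ ≤
      d * (6 * M * mesh N ^ 2) := by
  have hh := mesh_pos (N := N) (by omega)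
  simp only [lapH, ← Finset.sum_sub_distrib]
  refine (norm_sum_le_of_le _ fun i _ => ?_).trans
    (by simp : ∑ _i : Fin d, 6 * M * mesh N ^ 2 ≤ d * (6 * M * mesh N ^ 2))
  have h := norm_second_difference_sub_le hf (h1 i) (h3 i) hN I
  have e : (1 / mesh N ^ 2) • (fwd (restrictGrid d N f) i I - (2 : ℝ) • restrictGrid d N f I +
      bwd (restrictGrid d N f) i I) - partialD i (partialD i f) (gridPoint d N I) =
      (1 / mesh N ^ 2) • (fwd (restrictGrid d N f) i I - (2 : ℝ) • restrictGrid d N f I +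
      bwd (restrictGrid d N f) i I - mesh N ^ 2 • partialD i (partialD i f) (gridPoint d N I)) := by
    rw [smul_sub _ _ (mesh N ^ 2 • _), smul_smul, one_div_mul_cancel (by positivity), one_smul]
  rw [e, norm_smul, Real.norm_of_nonneg (by positivity), one_div, inv_mul_le_iff₀ (by positivity)]
  linarith

theorem norm_fwd_sub_le {M : ℝ} (hM : 0 ≤ M) {f : Space d → Vec3} (hN : 0 < N)
    (hf : DifferentiableOn ℝ f (cube d)) {i : Fin d} (hb : ∀ x ∈ cube d, ‖partialD i f x‖ ≤ M)
    (I : Fin d → Fin N) :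
    ‖fwd (restrictGrid d N f) i I - restrictGrid d N f I‖ ≤ M * mesh N := by
  have hh := mesh_pos hN
  set x := gridPoint d N I with hx
  have hxc : x ∈ cube d := gridPoint_mem_cube hN I
  have h := Convex.norm_image_sub_le_of_norm_hasDerivWithin_le (C := M)
    (fun r hr => hasDerivWithinAt_partialD hf hxc i hr)
    (fun r hr => hb _ (setCoord_mem_cube hxc i hr)) (convex_Icc (0 : ℝ) 1)
    (cell_mem_Icc hN (I i)) (cell_mem_Icc hN (nextIdx (I i)))
  have e1 : setCoord x i (((I i : ℕ) + 1 / 2) * mesh N) = x := setCoord_self x i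
  have e2 : ‖((nextIdx (I i) : ℕ) + 1 / 2 : ℝ) * mesh N - ((I i : ℕ) + 1 / 2) * mesh N‖ ≤
      mesh N := by
    rw [← sub_mul, norm_mul, Real.norm_of_nonneg hh.le]
    refine mul_le_of_le_one_left hh.le ?_
    rw [add_sub_add_right_eq_sub]
    by_cases hl : (I i : ℕ) + 1 < N
    · simp [nextIdx, hl]
    · simp [nextIdx, hl]
  rw [e1, hx, ← gridPoint_update] at h
  exact h.trans (by gcongr)

end Consistency

/-! ### Odd normal derivatives on the boundary -/

section Boundary

variable {d : ℕ}

theorem deriv_eq_zero_of_eq_const {E : Type*} [NormedAddCommGroup E] [NormedSpace ℝ E] {g : ℝ → E}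
    {v b : E} {s : ℝ} (hs : s ∈ Icc (0 : ℝ) 1) (hg : HasDerivWithinAt g v (Icc (0 : ℝ) 1) s)
    (hc : ∀ r ∈ Icc (0 : ℝ) 1, g r = b) : v = 0 :=
  (uniqueDiffOn_Icc_zero_one _ hs).eq_deriv _ hg
    ((hasDerivWithinAt_const s (Icc (0 : ℝ) 1) b).congr_of_mem hc hs)

open Filter Topology in
theorem deriv_eq_zero_of_growth {E : Type*} [NormedAddCommGroup E] [NormedSpace ℝ E] {g : ℝ → E}
    {v : E} {c C σ₀ : ℝ} (hc : c = 0 ∨ c = 1) (hg : HasDerivWithinAt g v (Icc (0 : ℝ) 1) c)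
    (hσ₀ : 0 < σ₀) (hC : ∀ σ, 0 < σ → σ ≤ σ₀ → ‖g |c - σ ^ 3| - g c‖ ≤ C * σ ^ 4) : v = 0 := by
  have hsmall : ∀ᶠ σ : ℝ in 𝓝[>] 0, 0 < σ ∧ σ ≤ σ₀ ∧ σ ≤ 1 := by
    have := Ioc_mem_nhdsGT (lt_min hσ₀ one_pos)
    filter_upwards [this] with σ hσ
    exact ⟨hσ.1, hσ.2.trans (min_le_left _ _), hσ.2.trans (min_le_right _ _)⟩
  have hdist : ∀ σ : ℝ, 0 < σ → σ ≤ 1 → |(|c - σ ^ 3|) - c| = σ ^ 3 ∧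
      |c - σ ^ 3| ∈ Icc (0 : ℝ) 1 := by
    intro σ h0 h1
    have p0 : 0 < σ ^ 3 := by positivity
    have p1 : σ ^ 3 ≤ 1 := pow_le_one₀ h0.le h1
    rcases hc with rfl | rfl
    · rw [zero_sub, abs_neg, abs_of_pos p0, sub_zero, abs_of_pos p0]
      exact ⟨rfl, p0.le, p1⟩
    · rw [abs_of_nonneg (by linarith : 0 ≤ 1 - σ ^ 3), sub_sub_cancel_left, abs_neg, abs_of_pos p0]
      exact ⟨rfl, by linarith, by linarith⟩
  have hc0 : |c| = c := by rcases hc with rfl | rfl <;> simp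
  have htend : Tendsto (fun σ : ℝ => |c - σ ^ 3|) (𝓝[>] 0) (𝓝[Icc (0 : ℝ) 1] c) := by
    refine tendsto_nhdsWithin_iff.mpr ⟨?_, ?_⟩
    · have : ContinuousAt (fun σ : ℝ => |c - σ ^ 3|) 0 := by fun_prop
      have h := this.tendsto
      simp only [ne_eq, OfNat.ofNat_ne_zero, not_false_eq_true, zero_pow, sub_zero, hc0] at h
      exact h.mono_left nhdsWithin_le_nhds
    · filter_upwards [hsmall] with σ hσ
      exact (hdist σ hσ.1 hσ.2.2).2
  have hlo := (hasDerivWithinAt_iff_isLittleO.mp hg).comp_tendsto htend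
  have hev : ∀ ε : ℝ, 0 < ε → ‖v‖ ≤ ε := by
    intro ε hε
    have h1 := (Asymptotics.isLittleO_iff.mp hlo) hε
    have h2 : ∀ᶠ σ : ℝ in 𝓝[>] 0, ‖v‖ ≤ ε + C * σ := by
      filter_upwards [h1, hsmall] with σ h hσ
      obtain ⟨hd, _⟩ := hdist σ hσ.1 hσ.2.2
      simp only [Function.comp_apply, Real.norm_eq_abs, hd] at h
      have h3 := hC σ hσ.1 hσ.2.1
      have h4 : ‖(|c - σ ^ 3| - c) • v‖ ≤ ε * σ ^ 3 + C * σ ^ 4 := by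
        have e : (|c - σ ^ 3| - c) • v = (g |c - σ ^ 3| - g c) -
            (g |c - σ ^ 3| - g c - (|c - σ ^ 3| - c) • v) := by abel
        rw [e]
        refine (norm_sub_le _ _).trans ?_
        linarith
      rw [norm_smul, Real.norm_eq_abs, hd] at h4
      refine le_of_mul_le_mul_left ?_ (pow_pos hσ.1 3)
      linarith
    have h5 : Tendsto (fun σ : ℝ => ε + C * σ) (𝓝[>] 0) (𝓝 ε) := by
      have : ContinuousAt (fun σ : ℝ => ε + C * σ) 0 := by fun_prop
      have h := this.tendsto
      simp only [mul_zero, add_zero] at h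
      exact h.mono_left nhdsWithin_le_nhds
    exact ge_of_tendsto h5 h2
  have := le_of_forall_pos_le_add (a := ‖v‖) (b := 0) fun ε hε => by simpa using hev ε hε
  simpa using this

/-- Along the solution the third normal derivative vanishes on the faces. -/
theorem partialD_three_eq_zero {M α : ℝ} {f q : Space d → Vec3} (hf : BoundedDerivs 4 M f)
    (hunit : ∀ x ∈ cube d, ‖f x‖ = 1)
    (h1 : ∀ i, ∀ x ∈ cube d, x i = 0 ∨ x i = 1 → partialD i f x = 0)
    (hq : ∀ x ∈ cube d, q x = - cross (f x) (∑ j, partialD j (partialD j f) x) -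
      α • cross (f x) (cross (f x) (∑ j, partialD j (partialD j f) x)))
    (hgrowth : ∀ i, ∀ x ∈ cube d, x i = 0 ∨ x i = 1 → ∃ C σ₀ : ℝ, 0 < σ₀ ∧
      ∀ σ, 0 < σ → σ ≤ σ₀ → ‖q (setCoord x i |x i - σ ^ 3|) - q x‖ ≤ C * σ ^ 4)
    (i : Fin d) {x : Space d} (hx : x ∈ cube d) (hxi : x i = 0 ∨ x i = 1) :
    partialD i (partialD i (partialD i f)) x = 0 := by
  have hxs : x i ∈ Icc (0 : ℝ) 1 := hx i
  have hself := setCoord_self x i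
  set z := partialD i (partialD i (partialD i f)) x with hz
  have d0 : ∀ r ∈ Icc (0 : ℝ) 1, HasDerivWithinAt (fun s => f (setCoord x i s))
      (partialD i f (setCoord x i r)) (Icc (0 : ℝ) 1) r := fun r hr =>
    hasDerivWithinAt_partialD hf.differentiableOn hx i hr
  have d1 : ∀ r ∈ Icc (0 : ℝ) 1, HasDerivWithinAt (fun s => partialD i f (setCoord x i s))
      (partialD i (partialD i f) (setCoord x i r)) (Icc (0 : ℝ) 1) r := fun r hr =>
    hasDerivWithinAt_partialD (hf.partialD i).differentiableOn hx i hr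
  have d2 : ∀ r ∈ Icc (0 : ℝ) 1, HasDerivWithinAt
      (fun s => partialD i (partialD i f) (setCoord x i s))
      (partialD i (partialD i (partialD i f)) (setCoord x i r)) (Icc (0 : ℝ) 1) r := fun r hr =>
    hasDerivWithinAt_partialD ((hf.partialD i).partialD i).differentiableOn hx i hr
  have hfx0 : partialD i f x = 0 := h1 i x hx hxi
  have horth1 : ∀ r ∈ Icc (0 : ℝ) 1,
      inner ℝ (f (setCoord x i r)) (partialD i f (setCoord x i r)) = 0 := by
    intro r hr
    have := deriv_eq_zero_of_eq_const (b := (1 : ℝ)) hr ((d0 r hr).inner ℝ (d0 r hr)) (by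
      intro s hs
      rw [real_inner_self_eq_norm_sq, hunit _ (setCoord_mem_cube hx i hs), one_pow])
    rw [real_inner_comm (partialD i f (setCoord x i r))] at this
    rw [real_inner_comm]
    linarith
  have horth2 : ∀ r ∈ Icc (0 : ℝ) 1,
      inner ℝ (f (setCoord x i r)) (partialD i (partialD i f) (setCoord x i r)) +
        inner ℝ (partialD i f (setCoord x i r)) (partialD i f (setCoord x i r)) = 0 :=
    fun r hr => deriv_eq_zero_of_eq_const hr ((d0 r hr).inner ℝ (d1 r hr)) horth1
  have horth3 : inner ℝ (f x) z = 0 := by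
    have := deriv_eq_zero_of_eq_const hxs (((d0 _ hxs).inner ℝ (d2 _ hxs)).add
      ((d1 _ hxs).inner ℝ (d1 _ hxs))) horth2
    rw [hself, hfx0, inner_zero_left, inner_zero_right] at this
    simpa using this
  have htan : ∀ j, j ≠ i → partialD i (partialD j (partialD j f)) x = 0 := by
    intro j hj
    have hface : ∀ g : Space d → Vec3, DifferentiableOn ℝ g (cube d) →
        (∀ y ∈ cube d, y i = x i → g y = 0) → ∀ y ∈ cube d, y i = x i → partialD j g y = 0 :=
      fun g hg h y hy hyi => partialD_eq_zero_of_face hg hj h hy hyi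
    have hC2 : ContDiffOn ℝ 2 f (cube d) := hf.1.of_le (by norm_num)
    rw [partialD_comm ((hf.partialD j).1.of_le (by norm_num)) i j hx,
      partialD_congr (fun y hy => partialD_comm hC2 i j hy) j hx]
    refine hface _ ((hf.partialD i).partialD j).differentiableOn ?_ x hx rfl
    refine hface _ (hf.partialD i).differentiableOn ?_
    intro y hy hyi
    exact h1 i y hy (by rwa [hyi])
  have dw : HasDerivWithinAt (fun s => ∑ j, partialD j (partialD j f) (setCoord x i s)) z
      (Icc (0 : ℝ) 1) (x i) := by
    have h := HasDerivWithinAt.fun_sum (u := Finset.univ) fun (j : Fin d) _ =>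
      hasDerivWithinAt_partialD ((hf.partialD j).partialD j).differentiableOn hx i hxs
    refine h.congr_deriv ?_
    rw [hself, Finset.sum_eq_single i (fun j _ hj => htan j hj) (by simp)]
  have dm := d0 _ hxs
  rw [hself, hfx0] at dm
  set w := ∑ j, partialD j (partialD j f) x with hw
  have dc : HasDerivWithinAt (fun s => cross (f (setCoord x i s))
      (∑ j, partialD j (partialD j f) (setCoord x i s))) (cross (f x) z) (Icc (0 : ℝ) 1) (x i) := by
    have h := crossL.hasDerivWithinAt_of_bilinear dm dw
    refine h.congr_deriv ?_
    rw [hself]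
    simp [crossL_apply]
  have dcc : HasDerivWithinAt (fun s => cross (f (setCoord x i s)) (cross (f (setCoord x i s))
      (∑ j, partialD j (partialD j f) (setCoord x i s)))) (cross (f x) (cross (f x) z))
      (Icc (0 : ℝ) 1) (x i) := by
    have h := crossL.hasDerivWithinAt_of_bilinear dm dc
    refine h.congr_deriv ?_
    rw [hself]
    simp [crossL_apply]
  have dq : HasDerivWithinAt (fun s => q (setCoord x i s))
      (- cross (f x) z - α • cross (f x) (cross (f x) z)) (Icc (0 : ℝ) 1) (x i) :=
    (dc.neg.sub (dcc.const_smul α)).congr_of_mem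
      (fun s hs => hq _ (setCoord_mem_cube hx i hs)) hxs
  obtain ⟨C, σ₀, hσ₀, hg⟩ := hgrowth i x hx hxi
  have hzero := deriv_eq_zero_of_growth hxi dq hσ₀ (by simpa only [hself] using hg)
  have hcross : cross (f x) z = 0 := by
    have h : inner ℝ (- cross (f x) z - α • cross (f x) (cross (f x) z)) (cross (f x) z) = 0 := by
      rw [hzero, inner_zero_left]
    rw [inner_sub_left, inner_neg_left, real_inner_smul_left, inner_cross_self_right,
      mul_zero, sub_zero, neg_eq_zero] at h
    exact inner_self_eq_zero.mp h
  have h := normSq_mul_inner (f x) z z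
  rw [horth3, hcross, inner_zero_left, hunit x hx] at h
  exact (inner_self_eq_zero (𝕜 := ℝ)).mp (by linarith)

end Boundary

/-! ### Regularity of the exact solution on the grid -/

theorem le_on_Icc_of_ae {T C : ℝ} (hT : 0 < T) {f : ℝ → ℝ} (hf : ContinuousOn f (Icc 0 T))
    (h : ∀ᵐ t ∂(volume.restrict (Icc 0 T)), f t ≤ C) : ∀ t ∈ Icc 0 T, f t ≤ C := by
  have h1 : (fun t => max (f t) C) =ᵐ[volume.restrict (Icc 0 T)] fun _ => C := by
    filter_upwards [h] with t ht using max_eq_right ht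
  have h2 := Measure.eqOn_Icc_of_ae_eq volume hT.ne h1 (hf.sup continuousOn_const) continuousOn_const
  intro t ht
  exact max_eq_right_iff.mp (h2 ht)

theorem le_on_Icc_of_ae_pos {T C : ℝ} (hT : 0 < T) {f : ℝ → ℝ} (hf : ContinuousOn f (Icc 0 T))
    {P : ℝ → Prop} (hP : ∀ᵐ t ∂(volume.restrict (Icc 0 T)), P t)
    (h : ∀ t ∈ Ioc 0 T, P t → f t ≤ C) : ∀ t ∈ Icc 0 T, f t ≤ C := by
  refine le_on_Icc_of_ae hT hf ?_
  have h0 : ∀ᵐ t ∂(volume.restrict (Icc 0 T)), t ≠ 0 := by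
    refine ae_restrict_of_ae ?_
    simp [ae_iff]
  filter_upwards [hP, ae_restrict_mem measurableSet_Icc, h0] with t h1 h2 h3
  exact h t ⟨lt_of_le_of_ne h2.1 h3.symm, h2.2⟩ h1

section Solution

variable {d : ℕ} {α T : ℝ} {m : ℝ → Space d → Vec3}

/-- Pointwise time derivatives up to third order with bounds uniform in space. -/
theorem TimeRegular.exists_derivs (hT : 0 < T) (hm : TimeRegular d T m) :
    ∃ K : ℝ, 0 ≤ K ∧ ∀ x ∈ cube d, ∃ m2 m3 : ℝ → Vec3, ∀ t ∈ Icc 0 T,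
      HasDerivWithinAt (fun s => m s x) (derivWithin (fun s => m s x) (Icc 0 T) t) (Icc 0 T) t ∧
      HasDerivWithinAt (derivWithin (fun s => m s x) (Icc 0 T)) (m2 t) (Icc 0 T) t ∧
      HasDerivWithinAt m2 (m3 t) (Icc 0 T) t ∧ ‖m2 t‖ ≤ K ∧ ‖m3 t‖ ≤ K := by
  obtain ⟨U, hU, hUm⟩ := hm
  have huniq := uniqueDiffOn_Icc hT
  set S := Icc 0 T with hS
  have hU1 : ContDiffOn ℝ 2 (derivWithin U S) S := hU.derivWithin huniq (by norm_num)
  set U1 := derivWithin U S with hU1def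
  have hU2 : ContDiffOn ℝ 1 (derivWithin U1 S) S := hU1.derivWithin huniq (by norm_num)
  set U2 := derivWithin U1 S with hU2def
  have hU3 : ContinuousOn (derivWithin U2 S) S := hU2.continuousOn_derivWithin huniq le_rfl
  set U3 := derivWithin U2 S with hU3def
  obtain ⟨K2, hK2⟩ := isCompact_Icc.exists_bound_of_continuousOn hU2.continuousOn
  obtain ⟨K3, hK3⟩ := isCompact_Icc.exists_bound_of_continuousOn hU3
  refine ⟨max 0 (max K2 K3), le_max_left _ _, fun x hx => ?_⟩
  set y : cube d := ⟨x, hx⟩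
  have eval : ∀ {F : ℝ → C(cube d, Vec3)} {F' : C(cube d, Vec3)} {t : ℝ},
      HasDerivWithinAt F F' S t → HasDerivWithinAt (fun s => F s y) (F' y) S t := fun h =>
    (ContinuousMap.evalCLM ℝ y : C(cube d, Vec3) →L[ℝ] Vec3).hasFDerivAt.comp_hasDerivWithinAt _ h
  have e0 : ∀ t ∈ S, HasDerivWithinAt (fun s => m s x) (U1 t y) S t := fun t ht =>
    (eval ((hU.differentiableOn (by norm_num)) t ht).hasDerivWithinAt).congr_of_mem
      (fun s hs => (hUm s hs y).symm) ht
  have e0' : ∀ t ∈ S, derivWithin (fun s => m s x) S t = U1 t y := fun t ht =>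
    (e0 t ht).derivWithin (huniq t ht)
  refine ⟨fun t => U2 t y, fun t => U3 t y, fun t ht => ⟨?_, ?_, ?_, ?_, ?_⟩⟩
  · rw [e0' t ht]; exact e0 t ht
  · exact (eval ((hU1.differentiableOn (by norm_num)) t ht).hasDerivWithinAt).congr_of_mem
      (fun s hs => e0' s hs) ht
  · exact eval ((hU2.differentiableOn (by norm_num)) t ht).hasDerivWithinAt
  · exact ((U2 t).norm_coe_le_norm y).trans ((hK2 t ht).trans
      ((le_max_left _ _).trans (le_max_right _ _)))
  · exact ((U3 t).norm_coe_le_norm y).trans ((hK3 t ht).trans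
      ((le_max_right _ _).trans (le_max_right _ _)))

theorem SpaceRegular.exists_boundedDerivs (hm : SpaceRegular d T m) :
    ∃ M : ℝ, 0 ≤ M ∧ ∀ᵐ t ∂(volume.restrict (Icc 0 T)), BoundedDerivs 4 M (m t) := by
  obtain ⟨M, hM⟩ := hm
  refine ⟨|M|, abs_nonneg M, ?_⟩
  filter_upwards [hM] with t ht
  exact ⟨by exact_mod_cast ht.1, fun j hj x hx => (ht.2 j hj x hx).trans (le_abs_self M)⟩

theorem IsSmoothSolution.partialD_eq_zero (hm : IsSmoothSolution d α T m) {t : ℝ}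
    (ht : t ∈ Icc 0 T) (i : Fin d) : ∀ x ∈ cube d, x i = 0 ∨ x i = 1 → partialD i (m t) x = 0 :=
  fun x hx hxi => hm.neumann t ht x hx i hxi

theorem IsSmoothSolution.derivWithin_eq (hm : IsSmoothSolution d α T m) {t : ℝ}
    (ht : t ∈ Icc 0 T) : ∀ x ∈ cube d, derivWithin (fun s => m s x) (Icc 0 T) t =
      - cross (m t x) (∑ j, partialD j (partialD j (m t)) x) -
      α • cross (m t x) (cross (m t x) (∑ j, partialD j (partialD j (m t)) x)) := by
  intro x hx
  rw [hm.equation t ht x hx, laplacianWithin_eq_sum_partialD (hm.classical t ht) hx]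

/-- Near a face the solution differs from its boundary values quadratically. -/
theorem IsSmoothSolution.norm_sub_face_le (hT : 0 < T) (hm : IsSmoothSolution d α T m) {M : ℝ}
    (hM : ∀ᵐ t ∂(volume.restrict (Icc 0 T)), BoundedDerivs 4 M (m t))
    (hc : ∀ x ∈ cube d, ContinuousOn (fun t => m t x) (Icc 0 T))
    (i : Fin d) {x : Space d} (hx : x ∈ cube d) (hxi : x i = 0 ∨ x i = 1) {s : ℝ}
    (hs : s ∈ Icc (0 : ℝ) 1) {t : ℝ} (ht : t ∈ Icc 0 T) :
    ‖m t (setCoord x i s) - m t x‖ ≤ M * (s - x i) ^ 2 := by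
  refine le_on_Icc_of_ae_pos hT ((hc _ (setCoord_mem_cube hx i hs)).sub (hc x hx)).norm hM ?_ t ht
  intro t ht hf
  have ht' : t ∈ Icc 0 T := Ioc_subset_Icc_self ht
  have h := taylor_two (convex_Icc (0 : ℝ) 1) (f := fun s => m t (setCoord x i s))
    (f1 := fun s => partialD i (m t) (setCoord x i s))
    (f2 := fun s => partialD i (partialD i (m t)) (setCoord x i s)) (C := M) (a := x i)
    (fun r hr => hasDerivWithinAt_partialD hf.differentiableOn hx i hr)
    (fun r hr => hasDerivWithinAt_partialD (hf.partialD i).differentiableOn hx i hr)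
    hf.nonneg (fun r hr => ((hf.partialD i).partialD i).norm_le (setCoord_mem_cube hx i hr))
    (hx i) hs
  rwa [setCoord_self, hm.partialD_eq_zero ht' i x hx hxi, smul_zero, sub_zero, sq_abs] at h

theorem IsSmoothSolution.growth_near_face (hT : 0 < T) (hm : IsSmoothSolution d α T m) {M : ℝ}
    (hM : ∀ᵐ t ∂(volume.restrict (Icc 0 T)), BoundedDerivs 4 M (m t))
    {t : ℝ} (ht : t ∈ Ioc 0 T) (i : Fin d) {x : Space d} (hx : x ∈ cube d)
    (hxi : x i = 0 ∨ x i = 1) :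
    ∃ C σ₀ : ℝ, 0 < σ₀ ∧ ∀ σ, 0 < σ → σ ≤ σ₀ →
      ‖derivWithin (fun s => m s (setCoord x i |x i - σ ^ 3|)) (Icc 0 T) t -
        derivWithin (fun s => m s x) (Icc 0 T) t‖ ≤ C * σ ^ 4 := by
  obtain ⟨K, hK, hder⟩ := hm.time_regular.exists_derivs hT
  have hc : ∀ x ∈ cube d, ContinuousOn (fun t => m t x) (Icc 0 T) := by
    intro x hx
    obtain ⟨m2, m3, h⟩ := hder x hx
    exact fun t ht => (h t ht).1.continuousWithinAt
  refine ⟨12 * K + 4 * M, min 1 (t / 2), lt_min one_pos (by linarith [ht.1]), ?_⟩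
  intro σ hσ hσ'
  have hσ1 : σ ≤ 1 := hσ'.trans (min_le_left _ _)
  have hσt : σ ≤ t / 2 := hσ'.trans (min_le_right _ _)
  have hσ2 : σ ^ 2 ≤ σ := by nlinarith
  have p0 : 0 < σ ^ 3 := by positivity
  have p1 : σ ^ 3 ≤ 1 := pow_le_one₀ hσ.le hσ1
  have q0 : 0 < σ ^ 2 := by positivity
  have hs : |x i - σ ^ 3| ∈ Icc (0 : ℝ) 1 ∧ (|x i - σ ^ 3| - x i) ^ 2 = σ ^ 6 := by
    rcases hxi with h | h
    · rw [h, zero_sub, abs_neg, abs_of_pos p0]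
      exact ⟨⟨p0.le, p1⟩, by ring⟩
    · rw [h, abs_of_nonneg (by linarith : 0 ≤ 1 - σ ^ 3)]
      exact ⟨⟨by linarith, by linarith⟩, by ring⟩
  set y := setCoord x i |x i - σ ^ 3| with hy
  have hyc : y ∈ cube d := setCoord_mem_cube hx i hs.1
  have hdiff : ∀ τ ∈ Icc 0 T, ‖m τ y - m τ x‖ ≤ M * σ ^ 6 := by
    intro τ hτ
    have := hm.norm_sub_face_le hT hM hc i hx hxi hs.1 hτ
    rwa [hs.2] at this
  have t0 : t ∈ Icc 0 T := Ioc_subset_Icc_self ht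
  have t1 : t - σ ^ 2 ∈ Icc 0 T := ⟨by linarith, by linarith [ht.2]⟩
  have t2 : t - 2 * σ ^ 2 ∈ Icc 0 T := ⟨by linarith, by linarith [ht.2]⟩
  have hb : ∀ z ∈ cube d, ‖(3 / 2 : ℝ) • m t z - (2 : ℝ) • m (t - σ ^ 2) z +
      (1 / 2 : ℝ) • m (t - 2 * σ ^ 2) z -
      σ ^ 2 • derivWithin (fun s => m s z) (Icc 0 T) t‖ ≤ 6 * K * σ ^ 6 := by
    intro z hz
    obtain ⟨m2, m3, h⟩ := hder z hz
    have := bdf_consistency (convex_Icc 0 T) (f := fun s => m s z) (fun r hr => (h r hr).1)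
      (fun r hr => (h r hr).2.1) (fun r hr => (h r hr).2.2.1) hK
      (fun r hr => (h r hr).2.2.2.2) q0.le t0 t1 t2
    refine this.trans (le_of_eq (by ring))
  have hbx := hb x hx
  have hby := hb y hyc
  set qx := derivWithin (fun s => m s x) (Icc 0 T) t
  set qy := derivWithin (fun s => m s y) (Icc 0 T) t
  set Bx := (3 / 2 : ℝ) • m t x - (2 : ℝ) • m (t - σ ^ 2) x + (1 / 2 : ℝ) • m (t - 2 * σ ^ 2) x
    with hBx
  set By := (3 / 2 : ℝ) • m t y - (2 : ℝ) • m (t - σ ^ 2) y + (1 / 2 : ℝ) • m (t - 2 * σ ^ 2) y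
    with hBy
  have hB : ‖By - Bx‖ ≤ 4 * (M * σ ^ 6) := by
    have e : By - Bx = (3 / 2 : ℝ) • (m t y - m t x) -
        (2 : ℝ) • (m (t - σ ^ 2) y - m (t - σ ^ 2) x) +
        (1 / 2 : ℝ) • (m (t - 2 * σ ^ 2) y - m (t - 2 * σ ^ 2) x) := by
      rw [hBx, hBy]; module
    rw [e]
    refine (norm_add_le _ _).trans ?_
    have := norm_sub_le ((3 / 2 : ℝ) • (m t y - m t x))
      ((2 : ℝ) • (m (t - σ ^ 2) y - m (t - σ ^ 2) x))
    rw [norm_smul, norm_smul, Real.norm_two,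
      Real.norm_of_nonneg (by norm_num : (0 : ℝ) ≤ 3 / 2)] at this
    rw [norm_smul (1 / 2 : ℝ), Real.norm_of_nonneg (by norm_num : (0 : ℝ) ≤ 1 / 2)]
    linarith [hdiff t t0, hdiff _ t1, hdiff _ t2]
  have hfin : ‖σ ^ 2 • (qy - qx)‖ ≤ (12 * K + 4 * M) * σ ^ 6 := by
    have e : σ ^ 2 • (qy - qx) = (By - Bx) + (Bx - σ ^ 2 • qx) - (By - σ ^ 2 • qy) := by module
    rw [e]
    refine (norm_sub_le _ _).trans ?_
    linarith [norm_add_le (By - Bx) (Bx - σ ^ 2 • qx)]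
  rw [norm_smul, Real.norm_of_nonneg q0.le] at hfin
  refine le_of_mul_le_mul_left ?_ q0
  linarith

variable {N : ℕ}

theorem IsSmoothSolution.norm_lapH_sub_le (hT : 0 < T) (hm : IsSmoothSolution d α T m) {M : ℝ}
    (hM : ∀ᵐ t ∂(volume.restrict (Icc 0 T)), BoundedDerivs 4 M (m t))
    {t : ℝ} (ht : t ∈ Ioc 0 T) (hf : BoundedDerivs 4 M (m t)) (hN : 2 ≤ N) (I : Fin d → Fin N) :
    ‖lapH (restrictGrid d N (m t)) I - ∑ i, partialD i (partialD i (m t)) (gridPoint d N I)‖ ≤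
      d * (6 * M * mesh N ^ 2) := by
  have ht' : t ∈ Icc 0 T := Ioc_subset_Icc_self ht
  refine LandauLifshitz.norm_lapH_sub_le hf (fun i => hm.partialD_eq_zero ht' i) ?_ hN I
  intro i x hx hxi
  exact partialD_three_eq_zero (q := fun x => derivWithin (fun s => m s x) (Icc 0 T) t) hf
    (hm.unit_length t ht') (fun i => hm.partialD_eq_zero ht' i) (hm.derivWithin_eq ht')
    (fun i x hx hxi => hm.growth_near_face hT hM ht i hx hxi) i hx hxi

theorem continuousOn_cross {S : Set ℝ} {a b : ℝ → Vec3} (ha : ContinuousOn a S)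
    (hb : ContinuousOn b S) : ContinuousOn (fun t => cross (a t) (b t)) S :=
  (crossL.continuous.comp_continuousOn ha).clm_apply hb

/-- Bounds for the point values of the solution on the grid, uniformly in time and in the mesh. -/
theorem IsSmoothSolution.exists_grid_bounds (hα : 0 < α) (hT : 0 < T)
    (hm : IsSmoothSolution d α T m) :
    ∃ K : ℝ, 0 ≤ K ∧ ∀ N : ℕ, 2 ≤ N → ∀ t ∈ Icc 0 T, ∀ I : Fin d → Fin N,
      (∀ i, ‖fwd (restrictGrid d N (m t)) i I - restrictGrid d N (m t) I‖ ≤ K * mesh N) ∧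
      ‖lapH (restrictGrid d N (m t)) I‖ ≤ K ∧
      (∀ i, ‖fwd (lapH (restrictGrid d N (m t))) i I - lapH (restrictGrid d N (m t)) I‖ ≤
        K * mesh N) ∧
      ‖derivWithin (fun s => m s (gridPoint d N I)) (Icc 0 T) t +
        cross (m t (gridPoint d N I)) (lapH (restrictGrid d N (m t)) I) +
        α • cross (m t (gridPoint d N I))
          (cross (m t (gridPoint d N I)) (lapH (restrictGrid d N (m t)) I))‖ ≤ K * mesh N ^ 2 := by
  obtain ⟨M, hM0, hM⟩ := hm.space_regular.exists_boundedDerivs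
  obtain ⟨K, hK, hder⟩ := hm.time_regular.exists_derivs hT
  have hP0 : 0 ≤ (d : ℝ) * M := by positivity
  set K' := M + 13 * (d * M) + (1 + α) * (6 * (d * M)) with hK'
  have hαP : 0 ≤ (1 + α) * (6 * (d * M)) := by positivity
  refine ⟨K', by positivity, fun N hN => ?_⟩
  have hN0 : 0 < N := by omega
  have hh := mesh_pos hN0
  have hh1 : mesh N ≤ 1 := mesh_le_one
  have hc : ∀ J, ContinuousOn (fun t => restrictGrid d N (m t) J) (Icc 0 T) := by
    intro J
    obtain ⟨m2, m3, h⟩ := hder _ (gridPoint_mem_cube hN0 J)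
    exact fun t ht => (h t ht).1.continuousWithinAt
  have hcV : ∀ J, ContinuousOn (derivWithin (fun s => m s (gridPoint d N J)) (Icc 0 T))
      (Icc 0 T) := by
    intro J
    obtain ⟨m2, m3, h⟩ := hder _ (gridPoint_mem_cube hN0 J)
    exact fun t ht => (h t ht).2.1.continuousWithinAt
  have hcL : ∀ J, ContinuousOn (fun t => lapH (restrictGrid d N (m t)) J) (Icc 0 T) := fun J =>
    continuousOn_finsetSum _ fun i _ =>
      (((hc _).sub ((hc J).const_smul (2 : ℝ))).add (hc _)).const_smul (1 / mesh N ^ 2)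
  have hLap : ∀ t ∈ Ioc 0 T, BoundedDerivs 4 M (m t) → ∀ J,
      ‖lapH (restrictGrid d N (m t)) J -
        restrictGrid d N (fun x => ∑ i, partialD i (partialD i (m t)) x) J‖ ≤
        6 * (d * M) * mesh N ^ 2 := fun t ht hf J =>
    (hm.norm_lapH_sub_le hT hM ht hf hN J).trans (le_of_eq (by ring))
  have hhP : 6 * (d * M) * mesh N ^ 2 ≤ 6 * (d * M) * mesh N := by
    gcongr; nlinarith
  intro t ht I
  refine ⟨fun i => ?_, ?_, fun i => ?_, ?_⟩
  · refine le_on_Icc_of_ae_pos hT ((hc _).sub (hc I)).norm hM ?_ t ht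
    intro t ht hf
    refine (norm_fwd_sub_le hM0 hN0 hf.differentiableOn
      (fun x hx => (hf.partialD i).norm_le hx) I).trans ?_
    gcongr
    linarith
  · refine le_on_Icc_of_ae_pos hT (hcL I).norm hM ?_ t ht
    intro t ht hf
    have h1 := hLap t ht hf I
    have h2 : ‖restrictGrid d N (fun x => ∑ i, partialD i (partialD i (m t)) x) I‖ ≤ d * M :=
      (norm_sum_le_of_le _ fun i _ => ((hf.partialD i).partialD i).norm_le
        (gridPoint_mem_cube hN0 I)).trans (by simp)
    have h3 := norm_le_norm_add_norm_sub'
      (lapH (restrictGrid d N (m t)) I)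
      (restrictGrid d N (fun x => ∑ i, partialD i (partialD i (m t)) x) I)
    have h4 : 6 * (d * M) * mesh N ≤ 6 * (d * M) := mul_le_of_le_one_right (by positivity) hh1
    linarith
  · refine le_on_Icc_of_ae_pos hT ((hcL _).sub (hcL I)).norm hM ?_ t ht
    intro t ht hf
    set L := restrictGrid d N (fun x => ∑ i, partialD i (partialD i (m t)) x) with hL
    have h1 := hLap t ht hf I
    have h2 := hLap t ht hf (Function.update I i (nextIdx (I i)))
    have h3 : ‖fwd L i I - L I‖ ≤ d * (M * mesh N) := by
      have e : fwd L i I - L I = ∑ j, (fwd (restrictGrid d N (partialD j (partialD j (m t)))) i I -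
          restrictGrid d N (partialD j (partialD j (m t))) I) := by
        simp [hL, fwd, restrictGrid]
      rw [e]
      refine (norm_sum_le_of_le _ fun j _ => norm_fwd_sub_le hM0 hN0
        ((hf.partialD j).partialD j).differentiableOn (fun x hx =>
          (((hf.partialD j).partialD j).partialD i).norm_le hx) I).trans (by simp)
    have e : fwd (lapH (restrictGrid d N (m t))) i I - lapH (restrictGrid d N (m t)) I =
        (fwd L i I - L I) + (fwd (lapH (restrictGrid d N (m t))) i I - fwd L i I) -
        (lapH (restrictGrid d N (m t)) I - L I) := by abel
    change ‖fwd (lapH (restrictGrid d N (m t))) i I - lapH (restrictGrid d N (m t)) I‖ ≤ _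
    rw [e]
    refine (norm_sub_le _ _).trans ?_
    have h4 := norm_add_le (fwd L i I - L I) (fwd (lapH (restrictGrid d N (m t))) i I - fwd L i I)
    have h5 : ‖fwd (lapH (restrictGrid d N (m t))) i I - fwd L i I‖ ≤ 6 * (d * M) * mesh N ^ 2 := h2
    have h6 : 0 ≤ M * mesh N := by positivity
    have h7 : 0 ≤ (1 + α) * (6 * (d * M)) * mesh N := by positivity
    rw [hK']
    linarith
  · refine le_on_Icc_of_ae_pos hT (((hcV I).add (continuousOn_cross (hc I) (hcL I))).add
      ((continuousOn_cross (hc I) (continuousOn_cross (hc I) (hcL I))).const_smul α)).norm hM ?_ t ht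
    intro t ht hf
    have h1 := hLap t ht hf I
    have ht' : t ∈ Icc 0 T := Ioc_subset_Icc_self ht
    have hx := gridPoint_mem_cube hN0 I
    have hunit := hm.unit_length t ht' _ hx
    have hV := hm.derivWithin_eq ht' _ hx
    change ‖derivWithin (fun s => m s (gridPoint d N I)) (Icc 0 T) t +
        cross (m t (gridPoint d N I)) (lapH (restrictGrid d N (m t)) I) +
        α • cross (m t (gridPoint d N I))
          (cross (m t (gridPoint d N I)) (lapH (restrictGrid d N (m t)) I))‖ ≤ _
    rw [hV]
    set a := m t (gridPoint d N I)
    set L := restrictGrid d N (fun x => ∑ i, partialD i (partialD i (m t)) x) with hL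
    set W := lapH (restrictGrid d N (m t)) I
    have hLI : ∑ j, partialD j (partialD j (m t)) (gridPoint d N I) = L I := rfl
    rw [hLI]
    have e : - cross a (L I) - α • cross a (cross a (L I)) + cross a W +
        α • cross a (cross a W) = cross a (W - L I) + α • cross a (cross a (W - L I)) := by
      simp only [cross_sub_right]; module
    rw [e]
    have n1 : ∀ v, ‖cross a v‖ ≤ ‖v‖ := by
      intro v
      have := norm_cross_le a v
      rwa [hunit, one_mul] at this
    refine (norm_add_le _ _).trans ?_
    rw [norm_smul, Real.norm_of_nonneg hα.le]
    have n2 := (n1 (W - L I)).trans h1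
    have n3 := mul_le_mul_of_nonneg_left ((n1 (cross a (W - L I))).trans n2) hα.le
    have h6 : 0 ≤ M * mesh N ^ 2 := by positivity
    have h7 : 0 ≤ (d * M) * mesh N ^ 2 := by positivity
    rw [hK']
    linarith

theorem IsSmoothSolution.exists_isConsistent (hα : 0 < α) (hT : 0 < T)
    (hm : IsSmoothSolution d α T m) {C₀ : ℝ} (hC₀ : 0 ≤ C₀) :
    ∃ K : ℝ, 0 ≤ K ∧ C₀ ≤ K ∧ ∀ (N : ℕ) (k : ℝ), 2 ≤ N → 0 < k → k ≤ C₀ * mesh N →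
      IsConsistent α T k K fun n => restrictGrid d N (m (n * k)) := by
  obtain ⟨Q, hQ, hgrid⟩ := hm.exists_grid_bounds hα hT
  obtain ⟨P, hP, hder⟩ := hm.time_regular.exists_derivs hT
  set K := C₀ + Q + 6 * P * C₀ ^ 2 + 6 * P * C₀ ^ 2 * (Q * (1 + 4 * α)) + 27 * P ^ 2 * C₀ ^ 3
    with hK
  have c1 : 0 ≤ 6 * P * C₀ ^ 2 := by positivity
  have c2 : 0 ≤ 6 * P * C₀ ^ 2 * (Q * (1 + 4 * α)) := by positivity
  have c3 : 0 ≤ 27 * P ^ 2 * C₀ ^ 3 := by positivity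
  have hQK : Q ≤ K := by linarith
  refine ⟨K, by positivity, by linarith, fun N k hN hk hkh => ?_⟩
  have hN0 : 0 < N := by omega
  have hh := mesh_pos hN0
  have hmem : ∀ n : ℕ, n * k ≤ T → (n : ℝ) * k ∈ Icc 0 T := fun n hn => ⟨by positivity, hn⟩
  have htimes : ∀ n : ℕ, ((n + 2 : ℕ) : ℝ) * k ≤ T →
      ((n + 2 : ℕ) : ℝ) * k ∈ Icc 0 T ∧ ((n + 1 : ℕ) : ℝ) * k = ((n + 2 : ℕ) : ℝ) * k - k ∧
      (n : ℝ) * k = ((n + 2 : ℕ) : ℝ) * k - 2 * k ∧ ((n + 2 : ℕ) : ℝ) * k - k ∈ Icc 0 T ∧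
      ((n + 2 : ℕ) : ℝ) * k - 2 * k ∈ Icc 0 T := by
    intro n hn
    have e1 : ((n + 1 : ℕ) : ℝ) * k = ((n + 2 : ℕ) : ℝ) * k - k := by push_cast; ring
    have e2 : (n : ℝ) * k = ((n + 2 : ℕ) : ℝ) * k - 2 * k := by push_cast; ring
    have p1 : 0 ≤ ((n + 1 : ℕ) : ℝ) * k := by positivity
    have p2 : 0 ≤ (n : ℝ) * k := by positivity
    exact ⟨hmem _ hn, e1, e2, ⟨by linarith, by linarith⟩, ⟨by linarith, by linarith⟩⟩
  have hsecond : ∀ n : ℕ, ((n + 2 : ℕ) : ℝ) * k ≤ T → ∀ x ∈ cube d,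
      ‖m ((n + 2 : ℕ) * k) x - (2 : ℝ) • m ((n + 1 : ℕ) * k) x + m (n * k) x‖ ≤
        6 * P * k ^ 2 := by
    intro n hn x hx
    obtain ⟨t0, e1, e2, t1, t2⟩ := htimes n hn
    obtain ⟨m2, m3, h⟩ := hder x hx
    rw [e1, e2]
    exact second_difference_le (f := fun s => m s x) (convex_Icc 0 T) (fun r hr => (h r hr).1)
      (fun r hr => (h r hr).2.1) hP (fun r hr => (h r hr).2.2.2.1) t0 t1 t2
  refine ⟨?_, ?_, ?_, ?_, ?_, ?_⟩
  · exact fun n hn I => hm.unit_length _ (hmem n hn) _ (gridPoint_mem_cube hN0 I)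
  · exact fun n hn I i => ((hgrid N hN _ (hmem n hn) I).1 i).trans (by gcongr)
  · exact fun n hn I => (hgrid N hN _ (hmem n hn) I).2.1.trans hQK
  · exact fun n hn I i => ((hgrid N hN _ (hmem n hn) I).2.2.1 i).trans (by gcongr)
  · intro n hn I
    obtain ⟨t0, e1, e2, t1, t2⟩ := htimes n hn
    have hx := gridPoint_mem_cube hN0 I
    obtain ⟨m2, m3, h⟩ := hder _ hx
    have hδ := hsecond n hn _ hx
    have hB := bdf_consistency (f := fun s => m s (gridPoint d N I)) (convex_Icc 0 T)
      (fun r hr => (h r hr).1)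
      (fun r hr => (h r hr).2.1) (fun r hr => (h r hr).2.2.1) hP
      (fun r hr => (h r hr).2.2.2.2) hk.le t0 t1 t2
    rw [← e1, ← e2] at hB
    obtain ⟨-, hW, -, hV⟩ := hgrid N hN _ t0 I
    have ha := hm.unit_length _ t0 _ hx
    have hb := hm.unit_length _ (show ((n + 1 : ℕ) : ℝ) * k ∈ Icc 0 T by rw [e1]; exact t1) _ hx
    have hcn := hm.unit_length _ (show (n : ℝ) * k ∈ Icc 0 T by rw [e2]; exact t2) _ hx
    simp only [extrap, restrictGrid, Pi.sub_apply, Pi.smul_apply]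
    change ‖_ + cross _ (lapH (restrictGrid d N (m ((n + 2 : ℕ) * k))) I) + α • cross _ (cross _
      (lapH (restrictGrid d N (m ((n + 2 : ℕ) * k))) I))‖ ≤ _
    set W := lapH (restrictGrid d N (m ((n + 2 : ℕ) * k))) I
    set V := derivWithin (fun s => m s (gridPoint d N I)) (Icc 0 T) ((n + 2 : ℕ) * k)
    set a := m ((n + 2 : ℕ) * k) (gridPoint d N I)
    set b := m ((n + 1 : ℕ) * k) (gridPoint d N I)
    set c := m (n * k) (gridPoint d N I)
    have hext := norm_extrap_le hb hcn
    have e : (1 / k) • ((3 / 2 : ℝ) • a - (2 : ℝ) • b + (1 / 2 : ℝ) • c) +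
        cross ((2 : ℝ) • b - c) W + α • cross ((2 : ℝ) • b - c) (cross ((2 : ℝ) • b - c) W) =
        (1 / k) • ((3 / 2 : ℝ) • a - (2 : ℝ) • b + (1 / 2 : ℝ) • c - k • V) +
        (V + cross a W + α • cross a (cross a W)) - cross (a - (2 : ℝ) • b + c) W -
        α • (cross a (cross (a - (2 : ℝ) • b + c) W) +
          cross (a - (2 : ℝ) • b + c) (cross ((2 : ℝ) • b - c) W)) := by
      rw [smul_sub _ _ (k • V), smul_smul, one_div_mul_cancel hk.ne', one_smul]
      simp only [cross_sub_left, cross_sub_right, cross_add_left, cross_add_right,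
        cross_smul_left, cross_smul_right]
      module
    rw [e]
    set δ := a - (2 : ℝ) • b + c
    set x := (2 : ℝ) • b - c
    have hk2 : k ^ 2 ≤ C₀ ^ 2 * mesh N ^ 2 := by rw [← mul_pow]; gcongr
    have n1 : ‖(1 / k) • ((3 / 2 : ℝ) • a - (2 : ℝ) • b + (1 / 2 : ℝ) • c - k • V)‖ ≤
        6 * P * k ^ 2 := by
      rw [norm_smul, Real.norm_of_nonneg (by positivity), one_div, inv_mul_le_iff₀ hk]
      linarith
    have n2 : ‖cross δ W‖ ≤ 6 * P * k ^ 2 * Q := (norm_cross_le _ _).trans (by gcongr)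
    have n3 : ‖cross a (cross δ W)‖ ≤ 1 * (6 * P * k ^ 2 * Q) :=
      (norm_cross_le _ _).trans (mul_le_mul ha.le n2 (norm_nonneg _) zero_le_one)
    have n4 : ‖cross δ (cross x W)‖ ≤ 6 * P * k ^ 2 * (3 * Q) :=
      (norm_cross_le _ _).trans (by gcongr; exact (norm_cross_le _ _).trans (by gcongr))
    have n5 : ‖α • (cross a (cross δ W) + cross δ (cross x W))‖ ≤
        α * (4 * (6 * P * k ^ 2 * Q)) := by
      rw [norm_smul, Real.norm_of_nonneg hα.le]
      gcongr
      refine (norm_add_le _ _).trans ?_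
      linarith
    refine (norm_sub_le _ _).trans ?_
    have n6 := norm_sub_le ((1 / k) • ((3 / 2 : ℝ) • a - (2 : ℝ) • b + (1 / 2 : ℝ) • c - k • V) +
        (V + cross a W + α • cross a (cross a W))) (cross δ W)
    have n7 := norm_add_le ((1 / k) • ((3 / 2 : ℝ) • a - (2 : ℝ) • b + (1 / 2 : ℝ) • c - k • V))
        (V + cross a W + α • cross a (cross a W))
    have r1 : 6 * P * k ^ 2 ≤ 6 * P * C₀ ^ 2 * mesh N ^ 2 := by
      rw [mul_assoc (6 * P)]; gcongr
    have r2 := mul_le_mul_of_nonneg_right r1 (by positivity : 0 ≤ Q * (1 + 4 * α))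
    have r3 : 0 ≤ 27 * P ^ 2 * C₀ ^ 3 * mesh N ^ 2 := by positivity
    have r4 : 0 ≤ C₀ * mesh N ^ 2 := by positivity
    rw [hK]
    linarith
  · intro n hn I
    obtain ⟨t0, e1, e2, t1, t2⟩ := htimes n hn
    have hx := gridPoint_mem_cube hN0 I
    have hδ := hsecond n hn _ hx
    have ha := hm.unit_length _ t0 _ hx
    have hb := hm.unit_length _ (show ((n + 1 : ℕ) : ℝ) * k ∈ Icc 0 T by rw [e1]; exact t1) _ hx
    have hcn := hm.unit_length _ (show (n : ℝ) * k ∈ Icc 0 T by rw [e2]; exact t2) _ hx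
    simp only [extrap, restrictGrid, Pi.sub_apply, Pi.smul_apply]
    rw [real_inner_smul_right, inner_extrap_bdf ha hb hcn]
    set δ := m ((n + 2 : ℕ) * k) (gridPoint d N I) -
      (2 : ℝ) • m ((n + 1 : ℕ) * k) (gridPoint d N I) + m (n * k) (gridPoint d N I)
    have e3 : |1 / k * (-(3 / 4) * ‖δ‖ ^ 2)| = 3 / 4 * ‖δ‖ ^ 2 / k := by
      rw [show 1 / k * (-(3 / 4) * ‖δ‖ ^ 2) = -(3 / 4 * ‖δ‖ ^ 2 / k) by ring, abs_neg,
        abs_of_nonneg (by positivity)]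
    rw [e3, div_le_iff₀ hk]
    have hk3 : k ^ 3 ≤ C₀ ^ 3 * mesh N ^ 3 := by rw [← mul_pow]; gcongr
    calc 3 / 4 * ‖δ‖ ^ 2 ≤ 3 / 4 * (6 * P * k ^ 2) ^ 2 := by gcongr
      _ = 27 * P ^ 2 * k ^ 3 * k := by ring
      _ ≤ 27 * P ^ 2 * (C₀ ^ 3 * mesh N ^ 3) * k := by gcongr
      _ = 27 * P ^ 2 * C₀ ^ 3 * mesh N ^ 3 * k := by ring
      _ ≤ K * mesh N ^ 3 * k := by gcongr; linarith

end Solution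

/-! ### The error norm -/

variable {d N : ℕ}

theorem normH_sq_add_normGradH_sq (f : Grid d N) : normH f ^ 2 + normGradH f ^ 2 = energy f := by
  have hm : 0 ≤ mesh N := by unfold mesh; positivity
  rw [normH, normGradH, Real.sq_sqrt (by positivity), Real.sq_sqrt (by positivity), energy,
    Finset.sum_add_distrib, mul_add]

theorem normH_add_normGradH_le {f : Grid d N} {R : ℝ} (hR : 0 ≤ R) (hf : energy f ≤ R ^ 2) :
    normH f + normGradH f ≤ 2 * R := by
  rw [← normH_sq_add_normGradH_sq] at hf
  have h1 : normH f ≤ R := le_of_sq_le_sq (by nlinarith [sq_nonneg (normGradH f)]) hR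
  have h2 : normGradH f ≤ R := le_of_sq_le_sq (by nlinarith [sq_nonneg (normH f)]) hR
  linarith

theorem energy_le_of_normH_add_le {f : Grid d N} {R : ℝ} (hf : normH f + normGradH f ≤ R) :
    energy f ≤ R ^ 2 := by
  rw [← normH_sq_add_normGradH_sq]
  have h1 : 0 ≤ normH f := Real.sqrt_nonneg _
  have h2 : 0 ≤ normGradH f := Real.sqrt_nonneg _
  nlinarith [mul_nonneg h1 h2]

theorem energy_le_of_norm_le (hN : 0 < N) {f : Grid d N} {B h₁ : ℝ} (h₁0 : 0 < h₁)
    (hh : h₁ ≤ mesh N) (hf : ∀ I, ‖f I‖ ≤ B) :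
    energy f ≤ (B + d * (2 * B / h₁)) ^ 2 := by
  have hm := mesh_pos hN
  have hB : 0 ≤ B := (norm_nonneg _).trans (hf fun _ => ⟨0, hN⟩)
  have hg : ∀ I i, ‖gradH f I i‖ ≤ 2 * B / h₁ := by
    intro I i
    have h1 : ‖fwd f i I - f I‖ ≤ 2 * B := by
      have h2 : ‖fwd f i I‖ ≤ B := hf _
      linarith [norm_sub_le (fwd f i I) (f I), hf I]
    rw [gradH, norm_smul, Real.norm_of_nonneg (by positivity), one_div, inv_mul_eq_div]
    gcongr
  have hG : 0 ≤ 2 * B / h₁ := by positivity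
  have hcell : ∀ I, ‖f I‖ ^ 2 + ∑ i, ‖gradH f I i‖ ^ 2 ≤
      (B + d * (2 * B / h₁)) ^ 2 * 1 := by
    intro I
    have h1 : ‖f I‖ ^ 2 ≤ B ^ 2 := by gcongr; exact hf I
    have h2 : ∑ i, ‖gradH f I i‖ ^ 2 ≤ d * (2 * B / h₁) ^ 2 := by
      refine (Finset.sum_le_sum fun i _ => pow_le_pow_left₀ (norm_nonneg _) (hg I i) 2).trans ?_
      simp
    have h3 : (d : ℝ) * (2 * B / h₁) ^ 2 ≤ d ^ 2 * (2 * B / h₁) ^ 2 := by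
      gcongr
      rcases Nat.eq_zero_or_pos d with h | h
      · simp [h]
      · have : (1 : ℝ) ≤ d := by exact_mod_cast h
        nlinarith
    have h4 : 0 ≤ B * (d * (2 * B / h₁)) := by positivity
    linarith
  unfold energy
  calc _ ≤ mesh N ^ d * ∑ _I : Fin d → Fin N, (B + d * (2 * B / h₁)) ^ 2 * 1 := by
        gcongr with I
        exact hcell I
    _ = (B + d * (2 * B / h₁)) ^ 2 * (mesh N ^ d * ∑ _I : Fin d → Fin N, (1 : ℝ)) := by
        rw [← Finset.mul_sum]; ring
    _ = _ := by rw [mesh_pow_mul_card hN, mul_one]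

end LandauLifshitz

open LandauLifshitz in
theorem theorem2p3 (d : ℕ) (hd : d = 1 ∨ d = 2 ∨ d = 3) (α T : ℝ) (hα : 0 < α) (hT : 0 < T)
    (me : ℝ → LandauLifshitz.Space d → LandauLifshitz.Vec3)
    (hme : LandauLifshitz.IsSmoothSolution d α T me) (C₀ C₁ : ℝ) :
    ∃ C : ℝ, 0 < C ∧
      ∀ (N : ℕ) (k : ℝ) (mt m : ℕ → LandauLifshitz.Grid d N),
        0 < N → 0 < k → k ≤ C₀ * LandauLifshitz.mesh N →
        LandauLifshitz.IsSchemeSolution α T k mt m →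
        (∀ l : ℕ, l ≤ 1 →
          LandauLifshitz.errH me k l (m l) ≤ C₁ * (k ^ 2 + LandauLifshitz.mesh N ^ 2) ∧
          LandauLifshitz.errH me k l (mt l) ≤ C₁ * (k ^ 2 + LandauLifshitz.mesh N ^ 2)) →
        ∀ n : ℕ, 2 ≤ n → (n : ℝ) * k ≤ T →
          LandauLifshitz.errH me k n (m n) ≤ C * (k ^ 2 + LandauLifshitz.mesh N ^ 2) := by
  have hd3 : d ≤ 3 := by omega
  obtain ⟨K, hK, hCK, hcons⟩ := hme.exists_isConsistent hα hT (abs_nonneg C₀)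
  set A₀ := (|C₁| * (|C₀| ^ 2 + 1)) ^ 2 with hA₀
  obtain ⟨Λ, h₀, hΛ, hh₀, hfine⟩ := exists_energy_error_le hα hT hK (by positivity : 0 ≤ A₀) hd3
  set h₁ := min h₀ (1 / 2) with hh₁
  have hh₁0 : 0 < h₁ := lt_min hh₀ (by norm_num)
  set R := 2 + d * (2 * 2 / h₁) with hR
  have hR0 : 0 < R := by positivity
  refine ⟨2 * Real.sqrt Λ + 2 * R / h₁ ^ 2, by positivity, ?_⟩
  intro N k mt m hN hk hkh hs hstart n hn hnT
  have hm := mesh_pos hN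
  have hkh' : k ≤ |C₀| * mesh N := hkh.trans (by gcongr; exact le_abs_self C₀)
  have hsum : mesh N ^ 2 ≤ k ^ 2 + mesh N ^ 2 := le_add_of_nonneg_left (sq_nonneg k)
  have hsΛ : 0 ≤ 2 * Real.sqrt Λ := by positivity
  have hRh : 0 ≤ 2 * R / h₁ ^ 2 := by positivity
  rcases le_or_gt (mesh N) h₁ with hcase | hcase
  · have hN2 : 2 ≤ N := by
      by_contra hlt
      have h1 : N = 1 := by omega
      have : mesh N ≤ 1 / 2 := hcase.trans (min_le_right _ _)
      rw [h1] at this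
      norm_num [mesh] at this
    have hk2 : k ^ 2 ≤ |C₀| ^ 2 * mesh N ^ 2 := by rw [← mul_pow]; gcongr
    have hinit : C₁ * (k ^ 2 + mesh N ^ 2) ≤ |C₁| * (|C₀| ^ 2 + 1) * mesh N ^ 2 := by
      calc _ ≤ |C₁| * (k ^ 2 + mesh N ^ 2) := by gcongr; exact le_abs_self C₁
        _ ≤ |C₁| * (|C₀| ^ 2 * mesh N ^ 2 + mesh N ^ 2) := by gcongr
        _ = _ := by ring
    have hE : ∀ f : Grid d N, normH f + normGradH f ≤ C₁ * (k ^ 2 + mesh N ^ 2) →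
        energy f ≤ A₀ * mesh N ^ 4 := by
      intro f hf
      refine (energy_le_of_normH_add_le (hf.trans hinit)).trans (le_of_eq ?_)
      rw [hA₀]; ring
    have hfinal := hfine N k (fun j => restrictGrid d N (me (j * k))) mt m hN hk
      (hkh'.trans (by gcongr)) (hcase.trans (min_le_left _ _)) (hcons N k hN2 hk hkh') hs
      (fun l hl => ⟨hE _ (hstart l hl).1, hE _ (hstart l hl).2⟩) n hnT
    have h1 := normH_add_normGradH_le (R := Real.sqrt Λ * mesh N ^ 2) (by positivity)
      (hfinal.trans (le_of_eq (by rw [mul_pow, Real.sq_sqrt hΛ.le]; ring)))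
    calc errH me k n (m n) ≤ 2 * Real.sqrt Λ * mesh N ^ 2 := by
          rw [mul_assoc]; exact h1
      _ ≤ (2 * Real.sqrt Λ + 2 * R / h₁ ^ 2) * (k ^ 2 + mesh N ^ 2) := by
          gcongr
          linarith
  · obtain ⟨l, rfl⟩ : ∃ l, n = l + 2 := ⟨n - 2, by omega⟩
    have hbound : ∀ I, ‖(restrictGrid d N (me ((l + 2 : ℕ) * k)) - m (l + 2)) I‖ ≤ 2 := by
      intro I
      have h1 : ‖restrictGrid d N (me ((l + 2 : ℕ) * k)) I‖ = 1 :=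
        hme.unit_length _ ⟨by positivity, hnT⟩ _ (gridPoint_mem_cube hN I)
      have h2 : ‖m (l + 2) I‖ ≤ 1 := by
        rw [hs.projection l hnT I, norm_smul, Real.norm_of_nonneg (by positivity)]
        rw [one_div]
        exact inv_mul_le_one_of_le₀ le_rfl (norm_nonneg _)
      have := norm_sub_le (restrictGrid d N (me ((l + 2 : ℕ) * k)) I) (m (l + 2) I)
      rw [Pi.sub_apply]
      linarith
    have h1 := normH_add_normGradH_le hR0.le (energy_le_of_norm_le hN hh₁0 hcase.le hbound)
    calc errH me k (l + 2 : ℕ) (m (l + 2)) ≤ 2 * R / h₁ ^ 2 * h₁ ^ 2 := by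
          rw [div_mul_cancel₀ _ (by positivity)]; exact h1
      _ ≤ (2 * Real.sqrt Λ + 2 * R / h₁ ^ 2) * (k ^ 2 + mesh N ^ 2) := by
          gcongr
          · linarith
          · exact (pow_le_pow_left₀ hh₁0.le hcase.le 2).trans hsum
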